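/- **Conventions.** Let $\mu$ be a non-principal ultrafilter on $\mathbb N=\{0,1,2,\dots\}$, and let $\alpha=(\alpha_n)_{n\in\mathbb N}$ be a scaling factor, i.e. a sequence of positive reals with $\alpha_n\to+\infty$. For a metric space $(X,d)$ with basepoint $e$, the asymptotic cone $\mathrm{Cone}_\mu(X,e,\alpha)$ is the set of sequences $(x_n)\in X^{\mathbb N}$ with $\mu\text{-}\lim d(x_n,e)/\alpha_n<\infty$, where $(x_n)$ and $(y_n)$ are identified when $\mu\text{-}\lim d(x_n,y_n)/\alpha_n=0$, with the metric $d_\infty([x_n],[y_n])=\mu\text{-}\lim d(x_n,y_n)/\alpha_n$. The iterated cones are $\mathrm{Cone}^0_\mu(X,e,\alpha)=X$ with basepoint $e(0)=e$, and $\mathrm{Cone}^{i+1}_\mu(X,e,\alpha)=\mathrm{Cone}_\mu(\mathrm{Cone}^i_\mu(X,e,\alpha),e(i),\alpha)$, with basepoint $e(i+1)$ the class of the constant sequence $e(i)$. For a sequence $a=(a_k)_{k\in\mathbb Z}\in\{0,1\}^{\mathbb Z}$ the *bullseye space* associated to $a$ is the following subset of $\mathbb R^3$, endowed with its path metric (the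 infimum of the lengths of paths inside the subset): the union of the $x$-axis and, for all $k\in\mathbb Z$, of - the circle of radius $2^k$ about the origin in the $xy$-plane; - the disc in the $xy$-plane having the interval $[2^k,2^{k+1}]$ of the $x$-axis as a diameter; - the closed $3$-dimensional ball having the interval $[-2^{k+1},-2^k]$ of the $x$-axis as a diameter; - if $a_k=1$, the segment $[2^k,2^{k+1}]$ of the $y$-axis. Its basepoint is the origin. The asymptotic density of $a$ is $\mathrm{ad}(a)=\limsup_{n\to\infty}\frac1{2n+1}\sum_{k=-n}^n a_k$. **Theorem.** There exist a bullseye space $X$, with basepoint $e$ the origin, and a scaling factor $\alpha$ such that, for every non-principal ultrafilter $\mu$ on $\mathbb N$ and all $i,j\in\mathbb N$ with $i\neq j$, the spaces $\mathrm{Cone}^i_\mu(X,e,\alpha)$ and $\mathrm{Cone}^j_\mu(X,e,\alpha)$ are not homeomorphic. Moreover, there are sequences $b^{(i)}\in\{0,1\}^{\mathbb Z}$, $i\in\mathbb N$, independent of $\mu$, with $\mathrm{ad}(b^{(i)})\neq \mathrm{ad}(b^{(j)})$ whenever $i\neq j$, such that, for every non-principal ultrafilter $\mu$ on $\mathbb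 N$ and every $i\in\mathbb N$, there is an isometry from $\mathrm{Cone}^i_\mu(X,e,\alpha)$ onto the bullseye space associated to $b^{(i)}$ that takes the basepoint of the cone to the origin. -/

import Mathlib

open Filter Topology Set
open scoped ENNReal NNReal

noncomputable section

/-! ### Ultralimits, asymptotic cones and their iterates -/

/-- The `μ`-limit of a sequence in the compact space `[0, ∞]`. -/
def ultraLim (μ : Ultrafilter ℕ) (f : ℕ → ℝ≥0∞) : ℝ≥0∞ := (μ.map f).lim

theorem tendsto_ultraLim (μ : Ultrafilter ℕ) (f : ℕ → ℝ≥0∞) :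
    Tendsto f μ (𝓝 (ultraLim μ f)) :=
  (μ.map f).le_nhds_lim

theorem ultraLim_eq {μ : Ultrafilter ℕ} {f : ℕ → ℝ≥0∞} {a : ℝ≥0∞}
    (h : Tendsto f μ (𝓝 a)) : ultraLim μ f = a :=
  tendsto_nhds_unique (tendsto_ultraLim μ f) h

/-- A scaling factor: a sequence of positive reals that diverges to infinity. -/
def IsScalingFactor (α : ℕ → ℝ) : Prop :=
  (∀ n, 0 < α n) ∧ Tendsto α atTop atTop

section Cone

variable {X : Type*} [MetricSpace X]

/-- `μ-lim d(xₙ, yₙ) / αₙ`, an element of `[0, ∞]`. -/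
def coneEDist (μ : Ultrafilter ℕ) (α : ℕ → ℝ) (x y : ℕ → X) : ℝ≥0∞ :=
  ultraLim μ fun n => ENNReal.ofReal (dist (x n) (y n) / α n)

theorem coneEDist_self (μ : Ultrafilter ℕ) (α : ℕ → ℝ) (x : ℕ → X) :
    coneEDist μ α x x = 0 := by
  apply ultraLim_eq
  simp

theorem coneEDist_comm (μ : Ultrafilter ℕ) (α : ℕ → ℝ) (x y : ℕ → X) :
    coneEDist μ α x y = coneEDist μ α y x := by
  simp only [coneEDist, dist_comm]

theorem coneEDist_triangle (μ : Ultrafilter ℕ) (α : ℕ → ℝ) (x y z : ℕ → X) :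
    coneEDist μ α x z ≤ coneEDist μ α x y + coneEDist μ α y z := by
  refine le_of_tendsto_of_tendsto' (tendsto_ultraLim μ _)
    ((tendsto_ultraLim μ _).add (tendsto_ultraLim μ _)) fun n => ?_
  rcases le_or_gt 0 (α n) with h | h
  · rw [← ENNReal.ofReal_add (by positivity) (by positivity), ← add_div]
    exact ENNReal.ofReal_le_ofReal (by gcongr; exact dist_triangle _ _ _)
  · rw [ENNReal.ofReal_of_nonpos (div_nonpos_of_nonneg_of_nonpos dist_nonneg h.le)]
    exact zero_le

/-- The sequences `x` in `X` with `μ-lim d(xₙ, eₙ) / αₙ < ∞`. -/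
structure ConeSeq (μ : Ultrafilter ℕ) (e : ℕ → X) (α : ℕ → ℝ) where
  seq : ℕ → X
  admissible : coneEDist μ α seq e < ∞

theorem ConeSeq.coneEDist_ne_top {μ : Ultrafilter ℕ} {e : ℕ → X} {α : ℕ → ℝ}
    (x y : ConeSeq μ e α) : coneEDist μ α x.seq y.seq ≠ ∞ := by
  refine ne_top_of_le_ne_top (ENNReal.add_ne_top.2 ⟨x.admissible.ne, ?_⟩)
    (coneEDist_triangle μ α x.seq e y.seq)
  rw [coneEDist_comm]
  exact y.admissible.ne

/-- The pseudometric `μ-lim d(xₙ, yₙ) / αₙ`. -/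
instance (μ : Ultrafilter ℕ) (e : ℕ → X) (α : ℕ → ℝ) : PseudoMetricSpace (ConeSeq μ e α) where
  dist x y := (coneEDist μ α x.seq y.seq).toReal
  dist_self x := by rw [coneEDist_self]; rfl
  dist_comm x y := by rw [coneEDist_comm]
  dist_triangle x y z := by
    rw [← ENNReal.toReal_add (x.coneEDist_ne_top y) (y.coneEDist_ne_top z)]
    exact ENNReal.toReal_mono
      (ENNReal.add_ne_top.2 ⟨x.coneEDist_ne_top y, y.coneEDist_ne_top z⟩)
      (coneEDist_triangle μ α x.seq y.seq z.seq)

/-- The asymptotic cone `Cone_μ(X, e, α)`: the quotient of the space of admissible sequences by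
the relation "at distance zero", with the induced metric. -/
abbrev AsymptoticCone (μ : Ultrafilter ℕ) (e : ℕ → X) (α : ℕ → ℝ) : Type _ :=
  SeparationQuotient (ConeSeq μ e α)

/-- The point `[eₙ]` of the asymptotic cone. -/
def AsymptoticCone.base (μ : Ultrafilter ℕ) (e : ℕ → X) (α : ℕ → ℝ) : AsymptoticCone μ e α :=
  SeparationQuotient.mk ⟨e, by rw [coneEDist_self]; exact ENNReal.zero_lt_top⟩

end Cone

/-- A metric space with a basepoint. -/
structure PointedMetricSpace where
  carrier : Type
  [metric : MetricSpace carrier]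
  base : carrier

attribute [instance] PointedMetricSpace.metric

/-- The asymptotic cone of a pointed space, taken along the constant sequence at its basepoint,
and pointed by the class of that sequence. -/
def PointedMetricSpace.cone (μ : Ultrafilter ℕ) (α : ℕ → ℝ) (P : PointedMetricSpace) :
    PointedMetricSpace where
  carrier := AsymptoticCone μ (fun _ => P.base) α
  base := AsymptoticCone.base μ (fun _ => P.base) α

/-- The iterated asymptotic cones `Coneⁱ_μ(X, e, α)`, with their basepoints. -/
def PointedMetricSpace.iterCone (μ : Ultrafilter ℕ) (α : ℕ → ℝ) (P : PointedMetricSpace) :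
    ℕ → PointedMetricSpace
  | 0 => P
  | i + 1 => (PointedMetricSpace.iterCone μ α P i).cone μ α

/-! ### The path metric on a subset of a metric space -/

section PathMetric

variable {E : Type*} [MetricSpace E]

/-- The length of a path in a subset of a metric space: its total variation. -/
def pathLength {S : Set E} {x y : S} (γ : Path x y) : ℝ≥0∞ :=
  eVariationOn (fun t => (γ t : E)) univ

/-- The infimum of the lengths of the paths in `S` from `x` to `y`. -/
def pathEDist {S : Set E} (x y : S) : ℝ≥0∞ := ⨅ γ : Path x y, pathLength γ

theorem pathEDist_self {S : Set E} (x : S) : pathEDist x x = 0 := by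
  refine le_antisymm (iInf_le_of_le (Path.refl x) ?_) zero_le
  refine (eVariationOn.constant_on ?_).le
  rintro _ ⟨s, -, rfl⟩ _ ⟨t, -, rfl⟩
  rfl

theorem pathLength_symm_le {S : Set E} {x y : S} (γ : Path x y) :
    pathLength γ.symm ≤ pathLength γ := by
  refine eVariationOn.comp_le_of_antitoneOn (fun t => (γ t : E)) unitInterval.symm ?_
    (mapsTo_univ _ _)
  intro s _ t _ h
  exact unitInterval.symm_le_symm.2 h

theorem pathEDist_comm {S : Set E} (x y : S) : pathEDist x y = pathEDist y x := by
  have key : ∀ x y : S, pathEDist x y ≤ pathEDist y x := fun x y =>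
    le_iInf fun γ => iInf_le_of_le γ.symm (pathLength_symm_le γ)
  exact le_antisymm (key x y) (key y x)

theorem pathLength_trans_le {S : Set E} {x y z : S} (γ : Path x y) (δ : Path y z) :
    pathLength (γ.trans δ) ≤ pathLength γ + pathLength δ := by
  let h : unitInterval := ⟨1 / 2, by norm_num, by norm_num⟩
  have hu : (univ : Set unitInterval) = Iic h ∪ Ici h := Iic_union_Ici.symm
  unfold pathLength
  rw [hu, eVariationOn.union _ (x := h) isGreatest_Iic isLeast_Ici, ← hu]
  gcongr
  · let φ : unitInterval → unitInterval := fun t => projIcc 0 1 zero_le_one (2 * (t : ℝ))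
    have hφ : Monotone φ := fun s t hst => by
      apply monotone_projIcc
      have : (s : ℝ) ≤ t := hst
      linarith
    have : EqOn (fun t => ((γ.trans δ) t : E)) ((fun t => (γ t : E)) ∘ φ) (Iic h) := by
      intro t ht
      have ht' : (t : ℝ) ≤ 1 / 2 := ht
      simp only [Path.trans_apply, Function.comp, ht', dif_pos, φ]
      rw [projIcc_of_mem]
    rw [eVariationOn.eq_of_eqOn this]
    exact eVariationOn.comp_le_of_monotoneOn _ φ (hφ.monotoneOn _) (mapsTo_univ _ _)
  · let φ : unitInterval → unitInterval := fun t => projIcc 0 1 zero_le_one (2 * (t : ℝ) - 1)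
    have hφ : Monotone φ := fun s t hst => by
      apply monotone_projIcc
      have : (s : ℝ) ≤ t := hst
      linarith
    have : EqOn (fun t => ((γ.trans δ) t : E)) ((fun t => (δ t : E)) ∘ φ) (Ici h) := by
      intro t ht
      have ht' : 1 / 2 ≤ (t : ℝ) := ht
      have e1 : (δ (φ t)) = δ.extend (2 * (t : ℝ) - 1) := rfl
      have e2 : ((γ.trans δ) t) = (γ.trans δ).extend t := by rw [Path.extend_apply]
      simp only [Function.comp]
      rw [e1, e2, Path.extend_trans_of_half_le _ _ ht']
    rw [eVariationOn.eq_of_eqOn this]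
    exact eVariationOn.comp_le_of_monotoneOn _ φ (hφ.monotoneOn _) (mapsTo_univ _ _)

theorem pathEDist_triangle {S : Set E} (x y z : S) :
    pathEDist x z ≤ pathEDist x y + pathEDist y z := by
  exact ENNReal.le_iInf_add_iInf fun γ δ =>
    iInf_le_of_le (γ.trans δ) (pathLength_trans_le γ δ)

theorem edist_le_pathEDist {S : Set E} (x y : S) : edist x y ≤ pathEDist x y := by
  refine le_iInf fun γ => ?_
  have h := eVariationOn.edist_le (fun t => (γ t : E)) (mem_univ (0 : unitInterval))
    (mem_univ (1 : unitInterval))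
  simpa using! h

theorem pathEDist_ne_top_of_lipschitz {S : Set E} {x y : S} {f : ℝ → E} {C : ℝ≥0}
    (hf : LipschitzOnWith C f (Icc 0 1)) (hS : ∀ t ∈ Icc (0 : ℝ) 1, f t ∈ S)
    (h0 : f 0 = x) (h1 : f 1 = y) : pathEDist x y ≠ ∞ := by
  let γ : Path x y :=
    { toFun := fun t => ⟨f t, hS t t.2⟩
      continuous_toFun := (hf.continuousOn.domRestrict).subtype_mk _
      source' := Subtype.ext h0
      target' := Subtype.ext h1 }
  refine ne_top_of_le_ne_top ?_ (iInf_le _ γ)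
  have h2 : eVariationOn (fun t : unitInterval => (t : ℝ)) univ ≤ ENNReal.ofReal (1 - 0) := by
    have h3 : eVariationOn (fun t : ℝ => t) (Icc 0 1 ∩ Icc 0 1) ≤ ENNReal.ofReal (1 - 0) :=
      ((monotone_id.monotoneOn _).eVariationOn_eq (by simp) (by simp)).le
    rw [inter_self] at h3
    refine le_trans ?_ h3
    exact eVariationOn.comp_le_of_monotoneOn (fun t : ℝ => t) (fun t : unitInterval => (t : ℝ))
      (fun s _ t _ h => h) (fun t _ => t.2)
  have h4 := hf.comp_eVariationOn_le (g := fun t : unitInterval => (t : ℝ)) (s := univ)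
    (fun t _ => t.2)
  refine ne_top_of_le_ne_top ?_ h4
  exact ENNReal.mul_ne_top ENNReal.coe_ne_top (ne_top_of_le_ne_top ENNReal.ofReal_ne_top h2)

end PathMetric

/-! ### Bullseye spaces -/

/-- Euclidean three-space; the plane containing the circles is `p 2 = 0`. -/
abbrev E3 : Type := EuclideanSpace ℝ (Fin 3)

/-- The circle of radius `2 ^ k` about the origin in the plane. -/
def bullCircle (k : ℤ) : Set E3 := {p | p 2 = 0 ∧ ‖p‖ = 2 ^ k}

/-- The `x`-axis. -/
def bullAxis : Set E3 := {p | p 1 = 0 ∧ p 2 = 0}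

/-- The planar disc having the interval `[2 ^ k, 2 ^ (k + 1)]` of the positive ray of the `x`-axis
as a diameter. -/
def bullDisc (k : ℤ) : Set E3 := {p | p 2 = 0 ∧ dist p !₂[3 / 2 * 2 ^ k, 0, 0] ≤ 2 ^ k / 2}

/-- The three-dimensional ball having the interval `[-2 ^ (k + 1), -2 ^ k]` of the negative ray of
the `x`-axis as a diameter. -/
def bullBall (k : ℤ) : Set E3 := {p | dist p !₂[-(3 / 2 * 2 ^ k), 0, 0] ≤ 2 ^ k / 2}

/-- The segment of the positive `y`-axis from the circle of radius `2 ^ k` to the circle of radius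
`2 ^ (k + 1)`. -/
def bullBridge (k : ℤ) : Set E3 := {p | p 0 = 0 ∧ p 2 = 0 ∧ 2 ^ k ≤ p 1 ∧ p 1 ≤ 2 ^ (k + 1)}

/-- The subset of three-space underlying the bullseye space of the 0-1 sequence `a`. -/
def bullseyeSet (a : ℤ → Fin 2) : Set E3 :=
  {p | p ∈ bullAxis ∨ ∃ k : ℤ,
    p ∈ bullCircle k ∨ p ∈ bullDisc k ∨ p ∈ bullBall k ∨ (a k = 1 ∧ p ∈ bullBridge k)}

theorem zero_mem_bullseyeSet (a : ℤ → Fin 2) : (0 : E3) ∈ bullseyeSet a :=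
  Or.inl ⟨rfl, rfl⟩

theorem pathEDist_ne_top_of_segment {S : Set E3} {x y : S}
    (h : segment ℝ (x : E3) y ⊆ S) : pathEDist x y ≠ ∞ := by
  refine pathEDist_ne_top_of_lipschitz (f := AffineMap.lineMap (x : E3) (y : E3))
    (lipschitzWith_lineMap (x : E3) (y : E3)).lipschitzOnWith (fun t ht => h ?_) (by simp) (by simp)
  rw [segment_eq_image_lineMap]
  exact mem_image_of_mem _ ht

theorem convex_bullAxis : Convex ℝ bullAxis := by
  intro p hp q hq s t _ _ _
  simp_all [bullAxis]

theorem convex_bullDisc (k : ℤ) : Convex ℝ (bullDisc k) := by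
  have h : bullDisc k = {p : E3 | p 2 = 0} ∩
      Metric.closedBall (!₂[3 / 2 * 2 ^ k, 0, 0] : E3) (2 ^ k / 2) := rfl
  rw [h]
  refine Convex.inter ?_ (convex_closedBall _ _)
  intro p hp q hq s t _ _ _
  simp_all

theorem convex_bullBall (k : ℤ) : Convex ℝ (bullBall k) :=
  convex_closedBall (!₂[-(3 / 2 * 2 ^ k), 0, 0] : E3) (2 ^ k / 2)

theorem convex_bullBridge (k : ℤ) : Convex ℝ (bullBridge k) := by
  rintro p ⟨h1, h2, h3, h4⟩ q ⟨g1, g2, g3, g4⟩ s t hs ht hst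
  refine ⟨by simp [h1, g1], by simp [h2, g2], ?_, ?_⟩
  · calc (2 : ℝ) ^ k = s * 2 ^ k + t * 2 ^ k := by rw [← add_mul, hst, one_mul]
      _ ≤ s * p 1 + t * q 1 := by gcongr
      _ = _ := by simp
  · calc _ = s * p 1 + t * q 1 := by simp
      _ ≤ s * 2 ^ (k + 1) + t * 2 ^ (k + 1) := by gcongr
      _ = _ := by rw [← add_mul, hst, one_mul]

/-- Every point of the space is joined to the origin by a path of finite length. -/
theorem pathEDist_origin_ne_top (a : ℤ → Fin 2) (x : bullseyeSet a) :
    pathEDist x ⟨0, zero_mem_bullseyeSet a⟩ ≠ ∞ := by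
  have step : ∀ x y : bullseyeSet a, pathEDist x y ≠ ∞ →
      pathEDist y ⟨0, zero_mem_bullseyeSet a⟩ ≠ ∞ →
      pathEDist x ⟨0, zero_mem_bullseyeSet a⟩ ≠ ∞ := fun x y h1 h2 =>
    ne_top_of_le_ne_top (ENNReal.add_ne_top.2 ⟨h1, h2⟩) (pathEDist_triangle _ _ _)
  have axis : ∀ x : bullseyeSet a, (x : E3) ∈ bullAxis →
      pathEDist x ⟨0, zero_mem_bullseyeSet a⟩ ≠ ∞ := fun x hx =>
    pathEDist_ne_top_of_segment
      ((convex_bullAxis.segment_subset hx ⟨rfl, rfl⟩).trans fun p hp => Or.inl hp)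
  have circle : ∀ (k : ℤ) (x : bullseyeSet a), (x : E3) ∈ bullCircle k →
      pathEDist x ⟨0, zero_mem_bullseyeSet a⟩ ≠ ∞ := by
    rintro k ⟨x, hxS⟩ ⟨hx2, hxn⟩
    have hy : (!₂[(2 : ℝ) ^ k, 0, 0] : E3) ∈ bullAxis := by constructor <;> simp
    refine step _ ⟨!₂[(2 : ℝ) ^ k, 0, 0], Or.inl hy⟩ ?_ (axis _ hy)
    rw [pathEDist_comm]
    let z : ℂ := ⟨x 0, x 1⟩
    have hz : ‖z‖ = 2 ^ k := by
      rw [← hxn, EuclideanSpace.norm_eq, Fin.sum_univ_three, Complex.norm_def, Complex.normSq_apply]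
      congr 1
      have : x 2 = 0 := hx2
      simp [this, z]
      ring
    let f : ℝ → E3 := fun t =>
      !₂[2 ^ k * Real.cos (t * z.arg), 2 ^ k * Real.sin (t * z.arg), 0]
    have hf : ContDiff ℝ 1 f := by
      rw [contDiff_euclidean]
      intro i
      fin_cases i <;> simp [f] <;> fun_prop
    obtain ⟨C, hC⟩ := hf.contDiffOn.exists_lipschitzOnWith (s := Icc 0 1) one_ne_zero
      (convex_Icc 0 1) isCompact_Icc
    refine pathEDist_ne_top_of_lipschitz hC (fun t _ => Or.inr ⟨k, Or.inl ⟨by simp [f], ?_⟩⟩) ?_ ?_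
    · rw [EuclideanSpace.norm_eq, Fin.sum_univ_three]
      have h5 : ‖f t 0‖ ^ 2 + ‖f t 1‖ ^ 2 + ‖f t 2‖ ^ 2 = ((2 : ℝ) ^ k) ^ 2 := by
        simp only [f, Real.norm_eq_abs, sq_abs]
        simp
        linear_combination ((2 : ℝ) ^ k) ^ 2 * Real.cos_sq_add_sin_sq (t * z.arg)
      rw [h5, Real.sqrt_sq (by positivity)]
    · simp [f]
    · ext i
      have h6 := Complex.norm_mul_cos_arg z
      have h7 := Complex.norm_mul_sin_arg z
      rw [hz] at h6 h7
      fin_cases i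
      · simp [f, h6, z]
      · simp [f, h7, z]
      · have : x 2 = 0 := hx2
        simp [f, this]
  rcases x with ⟨x, hx⟩
  rcases id hx with h | ⟨k, h | h | h | ⟨hk, h⟩⟩
  · exact axis _ h
  · exact circle k _ h
  · have hy : (!₂[3 / 2 * (2 : ℝ) ^ k, 0, 0] : E3) ∈ bullAxis := by constructor <;> simp
    have hy' : (!₂[3 / 2 * (2 : ℝ) ^ k, 0, 0] : E3) ∈ bullDisc k :=
      ⟨by simp, by rw [dist_self]; positivity⟩
    exact step _ ⟨_, Or.inl hy⟩ (pathEDist_ne_top_of_segment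
      (((convex_bullDisc k).segment_subset h hy').trans
        fun p hp => Or.inr ⟨k, Or.inr (Or.inl hp)⟩)) (axis _ hy)
  · have hy : (!₂[-(3 / 2 * (2 : ℝ) ^ k), 0, 0] : E3) ∈ bullAxis := by constructor <;> simp
    have hy' : (!₂[-(3 / 2 * (2 : ℝ) ^ k), 0, 0] : E3) ∈ bullBall k := by
      rw [bullBall, mem_ofPred_eq, dist_self]; positivity
    exact step _ ⟨_, Or.inl hy⟩ (pathEDist_ne_top_of_segment
      (((convex_bullBall k).segment_subset h hy').trans
        fun p hp => Or.inr ⟨k, Or.inr (Or.inr (Or.inl hp))⟩)) (axis _ hy)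
  · have hy : (!₂[0, (2 : ℝ) ^ k, 0] : E3) ∈ bullCircle k := by
      refine ⟨by simp, ?_⟩
      rw [EuclideanSpace.norm_eq, Fin.sum_univ_three]
      simp [Real.sqrt_sq (by positivity : (0 : ℝ) ≤ 2 ^ k)]
    have hy' : (!₂[0, (2 : ℝ) ^ k, 0] : E3) ∈ bullBridge k := by
      refine ⟨by simp, by simp, by simp, ?_⟩
      simp [zpow_le_zpow_right₀ (one_le_two : (1 : ℝ) ≤ 2) (Int.le_add_one le_rfl)]
    exact step _ ⟨_, Or.inr ⟨k, Or.inl hy⟩⟩ (pathEDist_ne_top_of_segment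
      (((convex_bullBridge k).segment_subset h hy').trans
        fun p hp => Or.inr ⟨k, Or.inr (Or.inr (Or.inr ⟨hk, hp⟩))⟩)) (circle k _ hy)

theorem pathEDist_bullseye_ne_top (a : ℤ → Fin 2) (x y : bullseyeSet a) :
    pathEDist x y ≠ ∞ := by
  refine ne_top_of_le_ne_top (ENNReal.add_ne_top.2 ⟨pathEDist_origin_ne_top a x, ?_⟩)
    (pathEDist_triangle x ⟨0, zero_mem_bullseyeSet a⟩ y)
  rw [pathEDist_comm]
  exact pathEDist_origin_ne_top a y

/-- The bullseye space associated to the 0-1 sequence `a`, which carries the path metric and not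
the metric induced from three-space. -/
structure Bullseye (a : ℤ → Fin 2) where
  pt : bullseyeSet a

/-- The path metric on the bullseye space. -/
instance (a : ℤ → Fin 2) : MetricSpace (Bullseye a) where
  dist x y := (pathEDist x.pt y.pt).toReal
  dist_self x := by rw [pathEDist_self]; rfl
  dist_comm x y := by rw [pathEDist_comm]
  dist_triangle x y z := by
    have h1 := pathEDist_bullseye_ne_top a x.pt y.pt
    have h2 := pathEDist_bullseye_ne_top a y.pt z.pt
    rw [← ENNReal.toReal_add h1 h2]
    exact ENNReal.toReal_mono (ENNReal.add_ne_top.2 ⟨h1, h2⟩) (pathEDist_triangle _ _ _)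
  eq_of_dist_eq_zero {x y} h := by
    have h3 := edist_le_pathEDist x.pt y.pt
    rcases (ENNReal.toReal_eq_zero_iff _).1 h with h | h
    · rw [h] at h3
      have h4 : x.pt = y.pt := edist_le_zero.1 h3
      cases x
      cases y
      exact congrArg Bullseye.mk h4
    · exact absurd h (pathEDist_bullseye_ne_top a x.pt y.pt)

/-- The basepoint of the bullseye space: the origin. -/
def Bullseye.origin (a : ℤ → Fin 2) : Bullseye a := ⟨⟨0, zero_mem_bullseyeSet a⟩⟩

/-- The bullseye space, pointed by the origin. -/
def pointedBullseye (a : ℤ → Fin 2) : PointedMetricSpace where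
  carrier := Bullseye a
  base := Bullseye.origin a

/-- The asymptotic density of a 0-1 sequence indexed by the integers. -/
def asymptoticDensity (a : ℤ → Fin 2) : ℝ :=
  limsup (fun n : ℕ => 1 / (2 * (n : ℝ) + 1) * ∑ k ∈ Finset.Icc (-(n : ℤ)) n, ((a k : ℕ) : ℝ)) atTop

end

/-! ### Estimates for the path metric -/

section PathMetricLemmas

variable {E : Type*} [MetricSpace E]

/-! Dividing the metric of the bullseye space of `a` by `2 ^ m` gives the bullseye space of the
shifted sequence `k ↦ a (k + m)` (`Bullseye.dist_dilate`). Hence, if the shifts of `b` by `m n`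
converge pointwise to `b'`, the cone of the space of `b` with scaling factor `2 ^ m n` is the space
of `b'` (`exists_cone_isometryEquiv`). Two facts carry this. Sequences that agree for `|k| ≤ N + 1`
give metrics that differ by at most `12 * 2 ^ (-N)` on common points of moderate norm, because a
curve can be rerouted through the origin when it enters the ball of radius `2 ^ (-N)`
(`Bullseye.dist_le_dist_add`). And a rescaled bounded sequence of points has a Euclidean ultralimit
which, if not the origin, is approached inside a single piece, where path metric and Euclidean
metric are comparable (`Bullseye.exists_limit`).

The sequences `bridgeSeq i` are built so that the shifts of each by `16 ^ (n + 1)` converge to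
`bridgeSeq (i + 1)`: ever longer central blocks of the next sequence sit at these places. One
scaling factor therefore serves every iteration. The blocks are so sparse that the density depends
only on the negative indices, where the zeros are the multiples of `i + 2`.

For non-homeomorphism, a topological invariant recovers `i`. The interior of the set of local cut
points is the complement of the axis, the discs and the balls (`Bullseye.graphPart_eq_thin`). Its
components are maximal families of half circles joined by bridges, and a family of `r` half circles
has `2 * r` boundary points. For `bridgeSeq i`, the components near the origin have one half circle
below the axis and `M = i + 2` above it. Any point whose neighbourhoods all contain components with
`n` boundary points forces `n = 2` or `n = 2 * M` (`Bullseye.eq_of_hasSmallComponents`), and the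
value `2 * M` occurs at the origin (`Bullseye.hasSmallComponents`). -/

theorem pathEDist_le_eVariationOn {S : Set E} {f : ℝ → E} {s t : ℝ} (hst : s ≤ t)
    (hf : ContinuousOn f (Icc s t)) (hS : ∀ r ∈ Icc s t, f r ∈ S) (x y : S)
    (hx : f s = x) (hy : f t = y) : pathEDist x y ≤ eVariationOn f (Icc s t) := by
  let φ : unitInterval → ℝ := fun u => s + u * (t - s)
  have hφ : Monotone φ := fun u v huv => by
    have h1 : (u : ℝ) ≤ v := huv
    have := mul_le_mul_of_nonneg_right h1 (sub_nonneg.2 hst)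
    simpa [φ] using this
  have hφm : ∀ u, φ u ∈ Icc s t := fun u => by
    have h0 := u.2.1
    have h1 := u.2.2
    constructor <;> simp only [φ] <;> nlinarith
  have hφc : Continuous φ := by fun_prop
  let γ : Path x y :=
    { toFun := fun u => ⟨f (φ u), hS _ (hφm u)⟩
      continuous_toFun := (hf.comp_continuous hφc hφm).subtype_mk _
      source' := Subtype.ext (by simp [φ, hx])
      target' := Subtype.ext (by simp [φ, hy]) }
  exact (iInf_le _ γ).trans
    (eVariationOn.comp_le_of_monotoneOn f φ (hφ.monotoneOn _) fun u _ => hφm u)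

theorem eVariationOn_le_of_lipschitzOnWith {f : ℝ → E} {C : ℝ≥0} {s t : ℝ} (hst : s ≤ t)
    (hf : LipschitzOnWith C f (Icc s t)) :
    eVariationOn f (Icc s t) ≤ C * ENNReal.ofReal (t - s) := by
  have h3 : eVariationOn (fun r : ℝ => r) (Icc s t ∩ Icc s t) ≤ ENNReal.ofReal (t - s) :=
    (MonotoneOn.eVariationOn_eq (monotone_id.monotoneOn _) (left_mem_Icc.2 hst)
      (right_mem_Icc.2 hst)).le
  rw [inter_self] at h3
  have h4 := hf.comp_eVariationOn_le (g := fun r : ℝ => r) (s := Icc s t) (fun r h => h)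
  exact h4.trans (by gcongr)

theorem exists_curve_of_pathEDist_lt {S : Set E} {x y : S} {c : ℝ≥0∞} (h : pathEDist x y < c) :
    ∃ f : ℝ → E, Continuous f ∧ (∀ r, f r ∈ S) ∧ f 0 = x ∧ f 1 = y ∧
      eVariationOn f (Icc 0 1) < c := by
  obtain ⟨γ, hγ⟩ := iInf_lt_iff.1 h
  refine ⟨fun r => (γ.extend r : E), by fun_prop, fun r => (γ.extend r).2, by simp, by simp,
    lt_of_le_of_lt ?_ hγ⟩
  exact eVariationOn.comp_le_of_monotoneOn (fun u => (γ u : E)) (projIcc 0 1 zero_le_one)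
    ((monotone_projIcc _).monotoneOn _) (mapsTo_univ _ _)

theorem pathEDist_map_le {S T : Set E} {h : E → E} {K : ℝ≥0} (hK : K ≠ 0) (hh : LipschitzWith K h)
    (hST : MapsTo h S T) (x y : S) :
    pathEDist (⟨h x, hST x.2⟩ : T) ⟨h y, hST y.2⟩ ≤ K * pathEDist x y := by
  unfold pathEDist
  -- A finite nonzero factor commutes with the infimum over paths; this is where `K ≠ 0` enters.
  rw [ENNReal.mul_iInf_of_ne (by simpa) (by simp)]
  refine le_iInf fun γ => iInf_le_of_le (γ.map (hh.continuous.restrict hST)) ?_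
  exact (hh.lipschitzOnWith (s := univ)).comp_eVariationOn_le (fun _ _ => mem_univ _)

end PathMetricLemmas

theorem pathEDist_le_of_segment {S : Set E3} {x y : S}
    (h : segment ℝ (x : E3) y ⊆ S) : pathEDist x y ≤ ENNReal.ofReal (dist (x : E3) y) := by
  have hl := (lipschitzWith_lineMap (𝕜 := ℝ) (x : E3) (y : E3)).lipschitzOnWith (s := Icc 0 1)
  refine (pathEDist_le_eVariationOn zero_le_one hl.continuousOn (fun t ht => h ?_) x y
    (by simp) (by simp)).trans ((eVariationOn_le_of_lipschitzOnWith zero_le_one hl).trans ?_)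
  · rw [segment_eq_image_lineMap]
    exact mem_image_of_mem _ ht
  · rw [sub_zero, ENNReal.ofReal_one, mul_one, ← ENNReal.ofReal_coe_nnreal, coe_nndist]

/-! ### The pieces of a bullseye space -/

theorem E3_norm_sq (p : E3) : ‖p‖ ^ 2 = p 0 ^ 2 + p 1 ^ 2 + p 2 ^ 2 := by
  rw [EuclideanSpace.norm_sq_eq, Fin.sum_univ_three]
  simp

theorem E3_ext {p q : E3} (h0 : p 0 = q 0) (h1 : p 1 = q 1) (h2 : p 2 = q 2) : p = q := by
  ext i
  fin_cases i <;> assumption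

/-- The point of the circle of radius `2 ^ k` with argument `θ`. -/
noncomputable def bullArc (k : ℤ) (θ : ℝ) : E3 := !₂[2 ^ k * Real.cos θ, 2 ^ k * Real.sin θ, 0]

@[simp] theorem bullArc_zero (k : ℤ) (θ : ℝ) : bullArc k θ 0 = 2 ^ k * Real.cos θ := rfl
@[simp] theorem bullArc_one (k : ℤ) (θ : ℝ) : bullArc k θ 1 = 2 ^ k * Real.sin θ := rfl
@[simp] theorem bullArc_two (k : ℤ) (θ : ℝ) : bullArc k θ 2 = 0 := rfl

theorem zpow_two_pos (k : ℤ) : (0 : ℝ) < 2 ^ k := by positivity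

@[simp] theorem norm_bullArc (k : ℤ) (θ : ℝ) : ‖bullArc k θ‖ = 2 ^ k := by
  have h : ‖bullArc k θ‖ ^ 2 = ((2 : ℝ) ^ k) ^ 2 := by
    rw [E3_norm_sq]
    simp only [bullArc_zero, bullArc_one, bullArc_two]
    linear_combination ((2 : ℝ) ^ k) ^ 2 * Real.cos_sq_add_sin_sq θ
  exact (sq_eq_sq₀ (norm_nonneg _) (zpow_two_pos k).le).1 h

theorem bullArc_mem_bullCircle (k : ℤ) (θ : ℝ) : bullArc k θ ∈ bullCircle k :=
  ⟨rfl, norm_bullArc k θ⟩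

theorem exists_bullArc_eq {k : ℤ} {p : E3} (hp : p ∈ bullCircle k) :
    ∃ θ, -Real.pi < θ ∧ θ ≤ Real.pi ∧ bullArc k θ = p := by
  obtain ⟨h2, hn⟩ := hp
  have h2' : p 2 = 0 := h2
  have hn' := E3_norm_sq p
  rw [hn, h2'] at hn'
  let z : ℂ := ⟨p 0, p 1⟩
  have hz : ‖z‖ = 2 ^ k := by
    refine (sq_eq_sq₀ (norm_nonneg _) (zpow_two_pos k).le).1 ?_
    rw [Complex.sq_norm, Complex.normSq_apply, hn']
    ring
  refine ⟨z.arg, Complex.neg_pi_lt_arg z, Complex.arg_le_pi z, E3_ext ?_ ?_ h2'.symm⟩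
  · simpa [hz] using Complex.norm_mul_cos_arg z
  · simpa [hz] using Complex.norm_mul_sin_arg z

theorem dist_bullArc_sq (k : ℤ) (θ φ : ℝ) :
    dist (bullArc k θ) (bullArc k φ) ^ 2 = (2 ^ k) ^ 2 * (2 - 2 * Real.cos (θ - φ)) := by
  rw [dist_eq_norm, E3_norm_sq, Real.cos_sub]
  simp only [PiLp.sub_apply, bullArc_zero, bullArc_one, bullArc_two]
  linear_combination ((2 : ℝ) ^ k) ^ 2 * Real.cos_sq_add_sin_sq θ +
    ((2 : ℝ) ^ k) ^ 2 * Real.cos_sq_add_sin_sq φ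

theorem lipschitzWith_bullArc (k : ℤ) : LipschitzWith (2 ^ k) (bullArc k) := by
  refine LipschitzWith.of_dist_le_mul fun θ φ => ?_
  have h := dist_bullArc_sq k θ φ
  have h1 := Real.one_sub_sq_div_two_le_cos (x := θ - φ)
  push_cast
  refine abs_le_of_sq_le_sq' ?_ (by positivity) |>.2
  rw [h, mul_pow, Real.dist_eq, sq_abs]
  gcongr
  linarith

/-- On `[-π, π]` one has `cos x ≤ 1 - (2 / π²) x²`, and `π ≤ 4` gives `2 / π² ≥ 1 / 8`, which is
just enough for the factor `2` between arc and chord. -/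
theorem mul_abs_sub_le_dist_bullArc (k : ℤ) {θ φ : ℝ} (h : |θ - φ| ≤ Real.pi) :
    2 ^ k * |θ - φ| ≤ 2 * dist (bullArc k θ) (bullArc k φ) := by
  have h1 := Real.cos_le_one_sub_mul_cos_sq h
  have hpi : Real.pi ≤ 4 := Real.pi_le_four
  have hpi0 := Real.pi_pos
  have h2 : (1 : ℝ) / 8 ≤ 2 / Real.pi ^ 2 := by
    rw [div_le_div_iff₀ (by norm_num) (by positivity)]
    nlinarith
  refine abs_le_of_sq_le_sq' ?_ (by positivity) |>.2
  rw [mul_pow, mul_pow, dist_bullArc_sq, sq_abs, ← mul_assoc, mul_comm (2 ^ 2 : ℝ), mul_assoc]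
  gcongr
  nlinarith [mul_le_mul_of_nonneg_right h2 (sq_nonneg (θ - φ))]

/-- The shorter of the two arcs is chosen, at the price of losing the order of the endpoints and
leaving the interval `(-π, π]`. -/
theorem exists_bullArc_eq_pair {k : ℤ} {p q : E3} (hp : p ∈ bullCircle k) (hq : q ∈ bullCircle k) :
    ∃ θ φ, θ ≤ φ ∧ φ - θ ≤ Real.pi ∧
      ((bullArc k θ = p ∧ bullArc k φ = q) ∨ (bullArc k θ = q ∧ bullArc k φ = p)) := by
  obtain ⟨θ, h1, h2, rfl⟩ := exists_bullArc_eq hp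
  obtain ⟨φ, h3, h4, rfl⟩ := exists_bullArc_eq hq
  have hper : ∀ x, bullArc k (x + 2 * Real.pi) = bullArc k x := fun x => by
    simp [bullArc, Real.cos_add_two_pi, Real.sin_add_two_pi]
  rcases le_total θ φ with h | h
  · by_cases h5 : φ - θ ≤ Real.pi
    · exact ⟨θ, φ, h, h5, Or.inl ⟨rfl, rfl⟩⟩
    · exact ⟨φ, θ + 2 * Real.pi, by linarith, by linarith, Or.inr ⟨rfl, hper θ⟩⟩
  · by_cases h5 : θ - φ ≤ Real.pi
    · exact ⟨φ, θ, h, h5, Or.inr ⟨rfl, rfl⟩⟩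
    · exact ⟨θ, φ + 2 * Real.pi, by linarith, by linarith, Or.inl ⟨rfl, hper φ⟩⟩

/-- The sets of which the bullseye space of `a` is the union. -/
inductive IsBullPiece (a : ℤ → Fin 2) : Set E3 → Prop
  | axis : IsBullPiece a bullAxis
  | circle (k : ℤ) : IsBullPiece a (bullCircle k)
  | disc (k : ℤ) : IsBullPiece a (bullDisc k)
  | ball (k : ℤ) : IsBullPiece a (bullBall k)
  | bridge (k : ℤ) (h : a k = 1) : IsBullPiece a (bullBridge k)

theorem IsBullPiece.subset {a : ℤ → Fin 2} {P : Set E3} (hP : IsBullPiece a P) :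
    P ⊆ bullseyeSet a := by
  intro p hp
  cases hP with
  | axis => exact Or.inl hp
  | circle k => exact Or.inr ⟨k, Or.inl hp⟩
  | disc k => exact Or.inr ⟨k, Or.inr (Or.inl hp)⟩
  | ball k => exact Or.inr ⟨k, Or.inr (Or.inr (Or.inl hp))⟩
  | bridge k h => exact Or.inr ⟨k, Or.inr (Or.inr (Or.inr ⟨h, hp⟩))⟩

theorem continuous_E3_apply (i : Fin 3) : Continuous fun p : E3 => p i := by fun_prop

theorem isClosed_bullAxis : IsClosed bullAxis :=
  (isClosed_eq (continuous_E3_apply 1) continuous_const).inter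
    (isClosed_eq (continuous_E3_apply 2) continuous_const)

theorem isClosed_bullCircle (k : ℤ) : IsClosed (bullCircle k) :=
  (isClosed_eq (continuous_E3_apply 2) continuous_const).inter
    (isClosed_eq continuous_norm continuous_const)

theorem isClosed_bullDisc (k : ℤ) : IsClosed (bullDisc k) :=
  (isClosed_eq (continuous_E3_apply 2) continuous_const).inter Metric.isClosed_closedBall

theorem isClosed_bullBall (k : ℤ) : IsClosed (bullBall k) :=
  Metric.isClosed_closedBall

theorem isClosed_bullBridge (k : ℤ) : IsClosed (bullBridge k) :=
  (isClosed_eq (continuous_E3_apply 0) continuous_const).inter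
    ((isClosed_eq (continuous_E3_apply 2) continuous_const).inter
    ((isClosed_le continuous_const (continuous_E3_apply 1)).inter
    (isClosed_le (continuous_E3_apply 1) continuous_const)))

theorem IsBullPiece.isClosed {a : ℤ → Fin 2} {P : Set E3} (hP : IsBullPiece a P) :
    IsClosed P := by
  cases hP with
  | axis => exact isClosed_bullAxis
  | circle k => exact isClosed_bullCircle k
  | disc k => exact isClosed_bullDisc k
  | ball k => exact isClosed_bullBall k
  | bridge k h => exact isClosed_bullBridge k

theorem zpow_two_succ (k : ℤ) : (2 : ℝ) ^ (k + 1) = 2 * 2 ^ k := by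
  rw [zpow_add_one₀ two_ne_zero, mul_comm]

theorem norm_mem_of_bullDisc {k : ℤ} {p : E3} (hp : p ∈ bullDisc k) :
    2 ^ k ≤ ‖p‖ ∧ ‖p‖ ≤ 2 ^ (k + 1) := by
  have hc : ‖(!₂[3 / 2 * 2 ^ k, 0, 0] : E3)‖ = 3 / 2 * 2 ^ k := by
    refine (sq_eq_sq₀ (norm_nonneg _) (by positivity)).1 ?_
    rw [E3_norm_sq]
    simp
  have h1 := hp.2
  rw [dist_eq_norm] at h1
  have h2 := norm_sub_norm_le p (!₂[3 / 2 * 2 ^ k, 0, 0] : E3)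
  have h3 := norm_sub_norm_le (!₂[3 / 2 * 2 ^ k, 0, 0] : E3) p
  rw [norm_sub_rev] at h3
  rw [zpow_two_succ]
  constructor <;> linarith

theorem norm_mem_of_bullBall {k : ℤ} {p : E3} (hp : p ∈ bullBall k) :
    2 ^ k ≤ ‖p‖ ∧ ‖p‖ ≤ 2 ^ (k + 1) := by
  have hc : ‖(!₂[-(3 / 2 * 2 ^ k), 0, 0] : E3)‖ = 3 / 2 * 2 ^ k := by
    refine (sq_eq_sq₀ (norm_nonneg _) (by positivity)).1 ?_
    rw [E3_norm_sq]
    simp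
  have h1 : dist p !₂[-(3 / 2 * 2 ^ k), 0, 0] ≤ 2 ^ k / 2 := hp
  rw [dist_eq_norm] at h1
  have h2 := norm_sub_norm_le p (!₂[-(3 / 2 * 2 ^ k), 0, 0] : E3)
  have h3 := norm_sub_norm_le (!₂[-(3 / 2 * 2 ^ k), 0, 0] : E3) p
  rw [norm_sub_rev] at h3
  rw [zpow_two_succ]
  constructor <;> linarith

theorem norm_eq_of_bullBridge {k : ℤ} {p : E3} (hp : p ∈ bullBridge k) : ‖p‖ = p 1 := by
  obtain ⟨h0, h2, h3, h4⟩ := hp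
  refine (sq_eq_sq₀ (norm_nonneg _) ((zpow_two_pos k).le.trans h3)).1 ?_
  rw [E3_norm_sq]
  simp [h0, h2]

theorem norm_mem_of_bullBridge {k : ℤ} {p : E3} (hp : p ∈ bullBridge k) :
    2 ^ k ≤ ‖p‖ ∧ ‖p‖ ≤ 2 ^ (k + 1) := by
  rw [norm_eq_of_bullBridge hp]
  exact ⟨hp.2.2.1, hp.2.2.2⟩

/-! ### Comparison of the path metric with the Euclidean metric. -/

namespace Bullseye

variable {a : ℤ → Fin 2}

theorem ofReal_dist (x y : Bullseye a) : ENNReal.ofReal (dist x y) = pathEDist x.pt y.pt :=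
  ENNReal.ofReal_toReal (pathEDist_bullseye_ne_top a _ _)

theorem dist_le_of_pathEDist_le {x y : Bullseye a} {c : ℝ} (hc : 0 ≤ c)
    (h : pathEDist x.pt y.pt ≤ ENNReal.ofReal c) : dist x y ≤ c :=
  ENNReal.toReal_le_of_le_ofReal hc h

theorem dist_pt_le (x y : Bullseye a) : dist (x.pt : E3) y.pt ≤ dist x y := by
  have h := edist_le_pathEDist x.pt y.pt
  rw [← ofReal_dist, Subtype.edist_eq, edist_dist] at h
  exact (ENNReal.ofReal_le_ofReal_iff dist_nonneg).1 h

theorem continuous_pt : Continuous fun x : Bullseye a => (x.pt : E3) :=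
  (LipschitzWith.of_dist_le_mul (K := 1) fun x y => by simpa using dist_pt_le x y).continuous

theorem dist_le_of_segment {x y : Bullseye a} (h : segment ℝ (x.pt : E3) y.pt ⊆ bullseyeSet a) :
    dist x y ≤ dist (x.pt : E3) y.pt :=
  dist_le_of_pathEDist_le dist_nonneg (pathEDist_le_of_segment h)

theorem dist_le_of_bullArc {k : ℤ} {θ φ : ℝ} (hθ : θ ≤ φ) (x y : Bullseye a)
    (hx : bullArc k θ = x.pt) (hy : bullArc k φ = y.pt) : dist x y ≤ 2 ^ k * (φ - θ) := by
  have hl := (lipschitzWith_bullArc k).lipschitzOnWith (s := Icc θ φ)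
  refine dist_le_of_pathEDist_le (by have := zpow_two_pos k; have := sub_nonneg.2 hθ; positivity)
    ((pathEDist_le_eVariationOn hθ hl.continuousOn (fun r _ => (IsBullPiece.circle k).subset
      (bullArc_mem_bullCircle k r)) x.pt y.pt hx hy).trans
      ((eVariationOn_le_of_lipschitzOnWith hθ hl).trans ?_))
  rw [ENNReal.ofReal_mul (zpow_two_pos k).le, ENNReal.ofReal, ENNReal.ofReal]
  gcongr
  rw [← NNReal.coe_le_coe, Real.coe_toNNReal _ (zpow_two_pos k).le]
  simp

/-- All pieces except the circles are convex, so the two metrics agree on them; on a circle the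
shorter arc is at most twice the chord. Thus Euclidean convergence within one piece implies
convergence in the path metric. -/
theorem dist_le_of_mem_piece {P : Set E3} (hP : IsBullPiece a P) {x y : Bullseye a}
    (hx : (x.pt : E3) ∈ P) (hy : (y.pt : E3) ∈ P) : dist x y ≤ 2 * dist (x.pt : E3) y.pt := by
  have conv : Convex ℝ P → dist x y ≤ 2 * dist (x.pt : E3) y.pt := fun hc =>
    (dist_le_of_segment ((hc.segment_subset hx hy).trans hP.subset)).trans
      (by linarith [dist_nonneg (x := (x.pt : E3)) (y := y.pt)])
  cases hP with
  | axis => exact conv convex_bullAxis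
  | circle k =>
    obtain ⟨θ, φ, h1, h2, ⟨h3, h4⟩ | ⟨h3, h4⟩⟩ := exists_bullArc_eq_pair hx hy
    · have h5 := mul_abs_sub_le_dist_bullArc k (θ := φ) (φ := θ)
        (by rwa [abs_of_nonneg (sub_nonneg.2 h1)])
      rw [abs_of_nonneg (sub_nonneg.2 h1), h3, h4, dist_comm] at h5
      exact (dist_le_of_bullArc h1 x y h3 h4).trans h5
    · have h5 := mul_abs_sub_le_dist_bullArc k (θ := φ) (φ := θ)
        (by rwa [abs_of_nonneg (sub_nonneg.2 h1)])
      rw [abs_of_nonneg (sub_nonneg.2 h1), h3, h4] at h5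
      rw [dist_comm]
      exact (dist_le_of_bullArc h1 y x h3 h4).trans h5
  | disc k => exact conv (convex_bullDisc k)
  | ball k => exact conv (convex_bullBall k)
  | bridge k h => exact conv (convex_bullBridge k)

theorem dist_origin_le_of_axis (x : Bullseye a) (hx : (x.pt : E3) ∈ bullAxis) :
    dist x (origin a) ≤ ‖(x.pt : E3)‖ := by
  have h := dist_le_of_segment (x := x) (y := origin a)
    ((convex_bullAxis.segment_subset hx ⟨rfl, rfl⟩).trans fun p hp => Or.inl hp)
  rwa [show ((origin a).pt : E3) = 0 from rfl, dist_zero_right] at h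

theorem norm_pt_le (x : Bullseye a) : ‖(x.pt : E3)‖ ≤ dist x (origin a) := by
  have h := dist_pt_le x (origin a)
  rwa [show ((origin a).pt : E3) = 0 from rfl, dist_zero_right] at h

/-- Move along the circle to the positive axis: the chord is at most `2 * 2 ^ k`, the arc at most `4
* 2 ^ k`, and the axis adds `2 ^ k`. -/
theorem dist_origin_le_of_circle {k : ℤ} (x : Bullseye a) (hx : (x.pt : E3) ∈ bullCircle k) :
    dist x (origin a) ≤ 5 * 2 ^ k := by
  have hax : bullArc k 0 ∈ bullAxis := by constructor <;> simp
  have h1 := dist_origin_le_of_axis (a := a) ⟨⟨bullArc k 0, Or.inl hax⟩⟩ hax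
  have h2 := dist_le_of_mem_piece (IsBullPiece.circle k) (x := x)
    (y := ⟨⟨bullArc k 0, Or.inl hax⟩⟩) hx (bullArc_mem_bullCircle k 0)
  have h3 := dist_triangle x ⟨⟨bullArc k 0, Or.inl hax⟩⟩ (origin a)
  have h4 := dist_le_norm_add_norm (x.pt : E3) (bullArc k 0)
  rw [hx.2, norm_bullArc] at h4
  rw [norm_bullArc] at h1
  dsimp only at h2
  linarith

/-- With `norm_pt_le`, this makes distance to the origin comparable to the norm, uniformly in `a`.
From a disc or ball the route goes through its centre to the axis, from a bridge through its inner
endpoint on a circle. The constant is not optimal. -/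
theorem dist_origin_le (x : Bullseye a) : dist x (origin a) ≤ 6 * ‖(x.pt : E3)‖ := by
  rcases id x.pt.2 with h | ⟨k, h | h | h | ⟨hk, h⟩⟩
  · exact (dist_origin_le_of_axis x h).trans (by linarith [norm_nonneg (x.pt : E3)])
  · have := dist_origin_le_of_circle x h
    rw [h.2]
    linarith [zpow_two_pos k]
  · have hax : (!₂[3 / 2 * (2 : ℝ) ^ k, 0, 0] : E3) ∈ bullAxis := by constructor <;> simp
    have hy' : (!₂[3 / 2 * (2 : ℝ) ^ k, 0, 0] : E3) ∈ bullDisc k :=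
      ⟨by simp, by rw [dist_self]; positivity⟩
    have h1 := dist_origin_le_of_axis (a := a) ⟨⟨_, Or.inl hax⟩⟩ hax
    have h2 := dist_le_of_mem_piece (IsBullPiece.disc k) (x := x) (y := ⟨⟨_, Or.inl hax⟩⟩) h hy'
    have h3 := dist_triangle x ⟨⟨_, Or.inl hax⟩⟩ (origin a)
    have h4 := norm_mem_of_bullDisc h
    have h5 := norm_mem_of_bullDisc hy'
    have h6 := h.2
    have h7 : ‖(!₂[3 / 2 * (2 : ℝ) ^ k, 0, 0] : E3)‖ ≤ 2 * 2 ^ k := by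
      rw [← zpow_two_succ]; exact h5.2
    dsimp only at h1 h2
    linarith
  · have hax : (!₂[-(3 / 2 * (2 : ℝ) ^ k), 0, 0] : E3) ∈ bullAxis := by constructor <;> simp
    have hy' : (!₂[-(3 / 2 * (2 : ℝ) ^ k), 0, 0] : E3) ∈ bullBall k := by
      rw [bullBall, mem_ofPred_eq, dist_self]; positivity
    have h1 := dist_origin_le_of_axis (a := a) ⟨⟨_, Or.inl hax⟩⟩ hax
    have h2 := dist_le_of_mem_piece (IsBullPiece.ball k) (x := x) (y := ⟨⟨_, Or.inl hax⟩⟩) h hy'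
    have h3 := dist_triangle x ⟨⟨_, Or.inl hax⟩⟩ (origin a)
    have h4 := norm_mem_of_bullBall h
    have h5 := norm_mem_of_bullBall hy'
    have h6 : dist (x.pt : E3) !₂[-(3 / 2 * 2 ^ k), 0, 0] ≤ 2 ^ k / 2 := h
    have h7 : ‖(!₂[-(3 / 2 * (2 : ℝ) ^ k), 0, 0] : E3)‖ ≤ 2 * 2 ^ k := by
      rw [← zpow_two_succ]; exact h5.2
    dsimp only at h1 h2
    linarith
  · have hc : bullArc k (Real.pi / 2) ∈ bullCircle k := bullArc_mem_bullCircle k _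
    have hb : bullArc k (Real.pi / 2) ∈ bullBridge k := by
      refine ⟨by simp, by simp, by simp, ?_⟩
      simp [zpow_le_zpow_right₀ (one_le_two : (1 : ℝ) ≤ 2) (Int.le_add_one le_rfl)]
    let y : Bullseye a := ⟨⟨_, (IsBullPiece.circle k).subset hc⟩⟩
    have h1 := dist_origin_le_of_circle y hc
    have h2 := dist_le_of_segment (x := x) (y := y)
      (((convex_bullBridge k).segment_subset h hb).trans (IsBullPiece.bridge k hk).subset)
    have h3 := dist_triangle x y (origin a)
    have h4 := norm_mem_of_bullBridge h
    have h5 : dist (x.pt : E3) (bullArc k (Real.pi / 2)) = ‖(x.pt : E3)‖ - 2 ^ k := by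
      rw [norm_eq_of_bullBridge h]
      refine (sq_eq_sq₀ dist_nonneg (sub_nonneg.2 h.2.2.1)).1 ?_
      rw [dist_eq_norm, E3_norm_sq]
      simp [h.1, h.2.1]
    change dist x y ≤ dist (x.pt : E3) (bullArc k (Real.pi / 2)) at h2
    linarith [zpow_two_pos k]

end Bullseye

/-! ### Dilations of bullseye spaces -/

theorem smul_mem_bullseyeSet {a : ℤ → Fin 2} {m : ℤ} {p : E3}
    (hp : p ∈ bullseyeSet fun k => a (k + m)) : (2 : ℝ) ^ m • p ∈ bullseyeSet a := by
  have hm := zpow_two_pos m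
  have hz : ∀ k : ℤ, (2 : ℝ) ^ (k + m) = 2 ^ m * 2 ^ k := fun k => by
    rw [zpow_add₀ two_ne_zero, mul_comm]
  have hd : ∀ c p : E3, ∀ r : ℝ, dist p c ≤ r → dist ((2 : ℝ) ^ m • p) ((2 : ℝ) ^ m • c) ≤ 2 ^ m * r :=
    fun c p r h => by
      rw [dist_smul₀, Real.norm_of_nonneg hm.le]
      gcongr
  rcases hp with ⟨h1, h2⟩ | ⟨k, ⟨h1, h2⟩ | ⟨h1, h2⟩ | h | ⟨hk, h1, h2, h3, h4⟩⟩
  · exact Or.inl ⟨by simp [h1], by simp [h2]⟩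
  · refine (IsBullPiece.circle (k + m)).subset ⟨by simp [h1], ?_⟩
    rw [norm_smul, h2, hz, Real.norm_of_nonneg hm.le]
  · refine (IsBullPiece.disc (k + m)).subset ⟨by simp [h1], ?_⟩
    convert! hd _ _ _ h2 using 1
    · congr 1
      ext i
      fin_cases i <;> simp [hz]
      ring
    · rw [hz]; ring
  · refine (IsBullPiece.ball (k + m)).subset ?_
    change dist _ _ ≤ _
    convert! hd _ _ _ h using 1
    · congr 1
      ext i
      fin_cases i <;> simp [hz]
      ring
    · rw [hz]; ring
  · refine (IsBullPiece.bridge (k + m) hk).subset ⟨by simp [h1], by simp [h2], ?_, ?_⟩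
    · rw [hz]; simpa [hm] using h3
    · rw [show k + m + 1 = (k + 1) + m by ring, hz]; simpa [hm] using h4

theorem smul_mem_bullseyeSet_shift {a : ℤ → Fin 2} {m : ℤ} {p : E3}
    (hp : p ∈ bullseyeSet a) : (2 : ℝ) ^ (-m) • p ∈ bullseyeSet fun k => a (k + m) := by
  apply smul_mem_bullseyeSet
  simpa using hp

namespace Bullseye

/-- The dilation by the factor `2 ^ m`. -/
noncomputable def dilate {a : ℤ → Fin 2} (m : ℤ) (x : Bullseye fun k => a (k + m)) : Bullseye a :=
  ⟨⟨(2 : ℝ) ^ m • (x.pt : E3), smul_mem_bullseyeSet x.pt.2⟩⟩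

/-- A dilation and its inverse are Lipschitz with reciprocal constants, so both inequalities are
equalities. -/
theorem dist_dilate {a : ℤ → Fin 2} (m : ℤ) (x y : Bullseye fun k => a (k + m)) :
    dist (dilate m x) (dilate m y) = 2 ^ m * dist x y := by
  have key : ∀ (S T : Set E3) (m : ℤ) (hST : MapsTo (fun p => (2 : ℝ) ^ m • p) S T) (x y : S),
      pathEDist (⟨_, hST x.2⟩ : T) ⟨_, hST y.2⟩ ≤ ENNReal.ofReal (2 ^ m) * pathEDist x y := by
    intro S T m hST x y
    refine (pathEDist_map_le (K := ‖(2 : ℝ) ^ m‖₊) (nnnorm_ne_zero_iff.2 (zpow_two_pos m).ne')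
      (lipschitzWith_smul _) hST x y).trans ?_
    gcongr
    rw [← ENNReal.ofReal_coe_nnreal, coe_nnnorm, Real.norm_of_nonneg (zpow_two_pos m).le]
  refine le_antisymm ?_ ?_
  · refine dist_le_of_pathEDist_le (mul_nonneg (zpow_two_pos m).le dist_nonneg) ?_
    rw [ENNReal.ofReal_mul (zpow_two_pos m).le, ofReal_dist]
    exact key _ _ m (fun p hp => smul_mem_bullseyeSet hp) x.pt y.pt
  · have h := key _ _ (-m) (fun p hp => smul_mem_bullseyeSet_shift (m := m) hp)
      (dilate m x).pt (dilate m y).pt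
    have h' : dist x y ≤ 2 ^ (-m) * dist (dilate m x) (dilate m y) := by
      refine dist_le_of_pathEDist_le (mul_nonneg (zpow_two_pos _).le dist_nonneg) ?_
      rw [ENNReal.ofReal_mul (zpow_two_pos _).le, ofReal_dist]
      convert h using 2 <;>
      · apply Subtype.ext
        simp [dilate, smul_smul, inv_mul_cancel₀ (zpow_two_pos m).ne']
    calc 2 ^ m * dist x y ≤ 2 ^ m * (2 ^ (-m) * dist (dilate m x) (dilate m y)) := by gcongr
      _ = _ := by rw [← mul_assoc, zpow_neg, mul_inv_cancel₀ (zpow_two_pos m).ne', one_mul]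

end Bullseye

/-! ### Dependence of the metric on the sequence -/

/-- Only bridges depend on the sequence, and the bridge `k` lies in the annulus `2 ^ k ≤ ‖p‖ ≤ 2 ^
(k + 1)`. Within the given norms this leaves `-N - 1 ≤ k ≤ N`. -/
theorem mem_bullseyeSet_of_agree {a b : ℤ → Fin 2} {N : ℕ}
    (hab : ∀ k : ℤ, |k| ≤ N + 1 → a k = b k) {p : E3} (hp : p ∈ bullseyeSet b)
    (h1 : (2 : ℝ) ^ (-(N : ℤ)) ≤ ‖p‖) (h2 : ‖p‖ ≤ 2 ^ (N : ℤ)) : p ∈ bullseyeSet a := by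
  rcases hp with h | ⟨k, h | h | h | ⟨hk, h⟩⟩
  · exact Or.inl h
  · exact (IsBullPiece.circle k).subset h
  · exact (IsBullPiece.disc k).subset h
  · exact (IsBullPiece.ball k).subset h
  · obtain ⟨h3, h4⟩ := norm_mem_of_bullBridge h
    have h5 := (zpow_le_zpow_iff_right₀ (one_lt_two : (1 : ℝ) < 2)).1 (h3.trans h2)
    have h6 := (zpow_le_zpow_iff_right₀ (one_lt_two : (1 : ℝ) < 2)).1 (h1.trans h4)
    refine (IsBullPiece.bridge k ?_).subset h
    rw [hab k (abs_le.2 ⟨by omega, by omega⟩), hk]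

/-- A nearly shortest curve for `b` is also a curve for `a` as long as its norm stays between `2 ^
(-N)` and `2 ^ N`. If it enters the ball of radius `r = 2 ^ (-N)`, the part between its first and
last visit is replaced by a detour through the origin, which costs at most `6 * r + 6 * r`. -/
theorem Bullseye.dist_le_dist_add {a b : ℤ → Fin 2} {N : ℕ}
    (hab : ∀ k : ℤ, |k| ≤ N + 1 → a k = b k) {p q : E3} (hpa : p ∈ bullseyeSet a)
    (hqa : q ∈ bullseyeSet a) (hpb : p ∈ bullseyeSet b) (hqb : q ∈ bullseyeSet b)
    (hN : 7 * (‖p‖ + ‖q‖) < 2 ^ (N : ℤ)) :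
    dist (⟨⟨p, hpa⟩⟩ : Bullseye a) ⟨⟨q, hqa⟩⟩ ≤
      dist (⟨⟨p, hpb⟩⟩ : Bullseye b) ⟨⟨q, hqb⟩⟩ + 12 * 2 ^ (-(N : ℤ)) := by
  set d := dist (⟨⟨p, hpb⟩⟩ : Bullseye b) ⟨⟨q, hqb⟩⟩ with hd
  set r : ℝ := 2 ^ (-(N : ℤ)) with hr
  have hr0 : 0 < r := zpow_two_pos _
  refine le_of_forall_pos_le_add fun ε hε => ?_
  -- The curve has length less than `d + δ` with `d ≤ 6 * (‖p‖ + ‖q‖)` and starts at `p`, so this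
  -- bound on `δ` keeps it in the ball of radius `2 ^ N`. This is the source of the `7` in `hN`.
  set δ := min ε (2 ^ (N : ℤ) - 7 * (‖p‖ + ‖q‖)) with hδ
  have hδ0 : 0 < δ := lt_min hε (sub_pos.2 hN)
  have hd0 : 0 ≤ d := dist_nonneg
  have hd6 : d ≤ 6 * ‖p‖ + 6 * ‖q‖ :=
    (dist_triangle_right _ _ (origin b)).trans (add_le_add (dist_origin_le _) (dist_origin_le _))
  have hlt : pathEDist (⟨p, hpb⟩ : bullseyeSet b) ⟨q, hqb⟩ < ENNReal.ofReal (d + δ) := by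
    have h := ofReal_dist (⟨⟨p, hpb⟩⟩ : Bullseye b) ⟨⟨q, hqb⟩⟩
    rw [← h]
    exact (ENNReal.ofReal_lt_ofReal_iff (by linarith)).2 (by linarith)
  obtain ⟨f, hfc, hfS, hf0, hf1, hfv⟩ := exists_curve_of_pathEDist_lt hlt
  dsimp only at hf0 hf1
  have hfn : ∀ t ∈ Icc (0 : ℝ) 1, ‖f t‖ ≤ 2 ^ (N : ℤ) := by
    intro t ht
    have h1 := (eVariationOn.edist_le f ht (left_mem_Icc.2 zero_le_one)).trans_lt hfv
    rw [edist_dist, ENNReal.ofReal_lt_ofReal_iff (by linarith), hf0, dist_eq_norm] at h1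
    have h2 := norm_sub_norm_le (f t) p
    have h3 : δ ≤ 2 ^ (N : ℤ) - 7 * (‖p‖ + ‖q‖) := min_le_right _ _
    linarith [norm_nonneg p, norm_nonneg q]
  suffices h : pathEDist (⟨p, hpa⟩ : bullseyeSet a) ⟨q, hqa⟩ ≤
      ENNReal.ofReal (d + δ + 12 * r) by
    refine (dist_le_of_pathEDist_le (by positivity) h).trans ?_
    linarith [min_le_left ε (2 ^ (N : ℤ) - 7 * (‖p‖ + ‖q‖))]
  by_cases hZ : ∃ t ∈ Icc (0 : ℝ) 1, ‖f t‖ ≤ r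
  swap
  · push Not at hZ
    refine (pathEDist_le_eVariationOn zero_le_one hfc.continuousOn (fun t ht =>
      mem_bullseyeSet_of_agree hab (hfS t) (hZ t ht).le (hfn t ht)) _ _ hf0 hf1).trans
      (hfv.le.trans (ENNReal.ofReal_le_ofReal (by linarith)))
  have hZc : IsCompact (Icc (0 : ℝ) 1 ∩ {t | ‖f t‖ ≤ r}) :=
    isCompact_Icc.inter_right (isClosed_le (by fun_prop) continuous_const)
  have hZn : (Icc (0 : ℝ) 1 ∩ {t | ‖f t‖ ≤ r}).Nonempty := by
    obtain ⟨t, ht, h⟩ := hZ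
    exact ⟨t, ht, h⟩
  obtain ⟨t1, ⟨ht1, hft1⟩, hl⟩ := hZc.exists_isLeast hZn
  obtain ⟨t2, ⟨ht2, hft2⟩, hg⟩ := hZc.exists_isGreatest hZn
  have h12 : t1 ≤ t2 := hl ⟨ht2, hft2⟩
  have hft1' : ‖f t1‖ ≤ r := hft1
  have hft2' : ‖f t2‖ ≤ r := hft2
  -- If `p` already lies in the small ball, then `t1 = 0` and only `p` itself is in question.
  -- Otherwise a point of smaller norm before `t1` would, by the intermediate value theorem, force a
  -- visit earlier than the first one.
  have hA : ∀ t ∈ Icc 0 t1, f t ∈ bullseyeSet a := by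
    intro t ht
    by_cases h0 : ‖f 0‖ ≤ r
    · have h4 : t1 ≤ 0 := hl ⟨left_mem_Icc.2 zero_le_one, h0⟩
      have h5 : t = 0 := le_antisymm (ht.2.trans h4) ht.1
      rw [h5, hf0]
      exact hpa
    · refine mem_bullseyeSet_of_agree hab (hfS t) ?_ (hfn t ⟨ht.1, ht.2.trans ht1.2⟩)
      by_contra! hlt
      obtain ⟨s, hs, hs'⟩ := intermediate_value_Icc' ht.1 (f := fun t => ‖f t‖)
        (by fun_prop) ⟨hlt.le, (not_le.1 h0).le⟩
      have h4 : t1 ≤ s := hl ⟨⟨hs.1, hs.2.trans (ht.2.trans ht1.2)⟩, le_of_eq hs'⟩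
      have h5 : s = t := le_antisymm hs.2 (ht.2.trans h4)
      rw [h5] at hs'
      exact hlt.ne hs'
  have hB : ∀ t ∈ Icc t2 1, f t ∈ bullseyeSet a := by
    intro t ht
    by_cases h0 : ‖f 1‖ ≤ r
    · have h4 : 1 ≤ t2 := hg ⟨right_mem_Icc.2 zero_le_one, h0⟩
      have h5 : t = 1 := le_antisymm ht.2 (h4.trans ht.1)
      rw [h5, hf1]
      exact hqa
    · refine mem_bullseyeSet_of_agree hab (hfS t) ?_ (hfn t ⟨ht2.1.trans ht.1, ht.2⟩)
      by_contra! hlt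
      obtain ⟨s, hs, hs'⟩ := intermediate_value_Icc ht.2 (f := fun t => ‖f t‖)
        (by fun_prop) ⟨hlt.le, (not_le.1 h0).le⟩
      have h4 : s ≤ t2 := hg ⟨⟨(ht2.1.trans ht.1).trans hs.1, hs.2⟩, le_of_eq hs'⟩
      have h5 : s = t := le_antisymm (h4.trans ht.1) hs.1
      rw [h5] at hs'
      exact hlt.ne hs'
  let u : bullseyeSet a := ⟨f t1, hA t1 (right_mem_Icc.2 ht1.1)⟩
  let v : bullseyeSet a := ⟨f t2, hB t2 (left_mem_Icc.2 ht2.2)⟩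
  have e1 : pathEDist ⟨p, hpa⟩ u ≤ eVariationOn f (Icc 0 t1) :=
    pathEDist_le_eVariationOn ht1.1 hfc.continuousOn hA _ _ hf0 rfl
  have e2 : pathEDist v ⟨q, hqa⟩ ≤ eVariationOn f (Icc t2 1) :=
    pathEDist_le_eVariationOn ht2.2 hfc.continuousOn hB _ _ rfl hf1
  have e3 : pathEDist u v ≤ ENNReal.ofReal (12 * r) := by
    have h := ofReal_dist (⟨u⟩ : Bullseye a) ⟨v⟩
    rw [← h]
    refine ENNReal.ofReal_le_ofReal ((dist_triangle_right _ _ (origin a)).trans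
      ((add_le_add (dist_origin_le _) (dist_origin_le _)).trans ?_))
    change 6 * ‖f t1‖ + 6 * ‖f t2‖ ≤ _
    linarith
  have e4 : eVariationOn f (Icc 0 t1) + eVariationOn f (Icc t2 1) ≤ eVariationOn f (Icc 0 1) :=
    (eVariationOn.add_le_union f fun x hx y hy => hx.2.trans (h12.trans hy.1)).trans
      (eVariationOn.mono f (union_subset (Icc_subset_Icc_right ht1.2) (Icc_subset_Icc_left ht2.1)))
  calc _ ≤ pathEDist ⟨p, hpa⟩ u + (pathEDist u v + pathEDist v ⟨q, hqa⟩) :=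
        (pathEDist_triangle _ u _).trans (by gcongr; exact pathEDist_triangle _ v _)
    _ ≤ eVariationOn f (Icc 0 t1) + (ENNReal.ofReal (12 * r) + eVariationOn f (Icc t2 1)) := by
        gcongr
    _ = (eVariationOn f (Icc 0 t1) + eVariationOn f (Icc t2 1)) + ENNReal.ofReal (12 * r) := by
        ring
    _ ≤ ENNReal.ofReal (d + δ) + ENNReal.ofReal (12 * r) := by
        gcongr
        exact e4.trans hfv.le
    _ = _ := (ENNReal.ofReal_add (by positivity) (by positivity)).symm

/-! ### Asymptotic cones of bullseye spaces -/

theorem ultrafilter_le_atTop {μ : Ultrafilter ℕ} (hμ : ∀ n : ℕ, μ ≠ pure n) :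
    (μ : Filter ℕ) ≤ atTop := by
  rw [← Nat.cofinite_eq_atTop]
  exact μ.le_cofinite_or_eq_pure.resolve_right fun ⟨n, hn⟩ => hμ n hn

theorem coneEDist_eq_of_tendsto {X : Type*} [MetricSpace X] {μ : Ultrafilter ℕ} {α : ℕ → ℝ}
    {x y : ℕ → X} {c : ℝ} (h : Tendsto (fun n => dist (x n) (y n) / α n) μ (𝓝 c)) :
    coneEDist μ α x y = ENNReal.ofReal c :=
  ultraLim_eq ((ENNReal.continuous_ofReal.tendsto c).comp h)

section BullseyeCone

variable {b b' : ℤ → Fin 2} {m : ℕ → ℕ}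

theorem eventually_agree (hb : ∀ k : ℤ, ∀ᶠ n in atTop, b (k + m n) = b' k) (N : ℕ) :
    ∀ᶠ n in atTop, ∀ k : ℤ, |k| ≤ N + 1 → b (k + m n) = b' k := by
  have h := (eventually_all_finset (Finset.Icc (-(N + 1 : ℤ)) (N + 1))).2 fun k _ => hb k
  filter_upwards [h] with n hn k hk
  exact hn k (Finset.mem_Icc.2 (abs_le.1 hk))

theorem eventually_mem_bullseyeSet (hb : ∀ k : ℤ, ∀ᶠ n in atTop, b (k + m n) = b' k) {p : E3}
    (hp : p ∈ bullseyeSet b') : ∀ᶠ n in atTop, p ∈ bullseyeSet fun k => b (k + m n) := by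
  rcases hp with h | ⟨k, h | h | h | ⟨hk, h⟩⟩
  · exact Eventually.of_forall fun _ => Or.inl h
  · exact Eventually.of_forall fun _ => (IsBullPiece.circle k).subset h
  · exact Eventually.of_forall fun _ => (IsBullPiece.disc k).subset h
  · exact Eventually.of_forall fun _ => (IsBullPiece.ball k).subset h
  · filter_upwards [hb k] with n hn
    exact (IsBullPiece.bridge k (by rw [hn, hk])).subset h

open Classical in
/-- The point `2 ^ m • p`, or the origin where the former is not a point of the space. -/
noncomputable def Bullseye.scaledPoint (b : ℤ → Fin 2) (p : E3) (m : ℤ) : Bullseye b :=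
  if h : p ∈ bullseyeSet fun k => b (k + m) then Bullseye.dilate m ⟨⟨p, h⟩⟩ else Bullseye.origin b

theorem Bullseye.scaledPoint_of_mem {p : E3} {m : ℤ} (h : p ∈ bullseyeSet fun k => b (k + m)) :
    Bullseye.scaledPoint b p m = Bullseye.dilate m ⟨⟨p, h⟩⟩ := dif_pos h

theorem Bullseye.scaledPoint_zero (m : ℤ) : Bullseye.scaledPoint b 0 m = Bullseye.origin b := by
  rw [scaledPoint_of_mem (zero_mem_bullseyeSet _)]
  simp [dilate, origin]

/-- After rescaling, both points are fixed and only the sequence varies. It agrees with `b'` on any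
given finite window for large `n`, so `dist_le_dist_add` applies in both directions. -/
theorem Bullseye.tendsto_dist_scaledPoint (hb : ∀ k : ℤ, ∀ᶠ n in atTop, b (k + m n) = b' k)
    (x y : Bullseye b') :
    Tendsto (fun n => dist (scaledPoint b (x.pt : E3) (m n)) (scaledPoint b (y.pt : E3) (m n)) /
      2 ^ (m n : ℤ)) atTop (𝓝 (dist x y)) := by
  rw [Metric.tendsto_nhds]
  intro ε hε
  have hbig : Tendsto (fun N : ℕ => (2 : ℝ) ^ (N : ℤ)) atTop atTop := by
    simpa using tendsto_pow_atTop_atTop_of_one_lt (one_lt_two : (1 : ℝ) < 2)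
  have hsmall : Tendsto (fun N : ℕ => 12 * (2 : ℝ) ^ (-(N : ℤ))) atTop (𝓝 0) := by
    simpa [zpow_neg] using (tendsto_inv_atTop_zero.comp hbig).const_mul 12
  obtain ⟨N, hN1, hN2⟩ := ((hbig.eventually_gt_atTop (7 * (‖(x.pt : E3)‖ + ‖(y.pt : E3)‖))).and
    (hsmall.eventually_lt_const hε)).exists
  filter_upwards [eventually_agree hb N, eventually_mem_bullseyeSet hb x.pt.2,
    eventually_mem_bullseyeSet hb y.pt.2] with n hn hx hy
  rw [scaledPoint_of_mem hx, scaledPoint_of_mem hy, dist_dilate,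
    mul_div_cancel_left₀ _ (zpow_two_pos _).ne', Real.dist_eq, abs_sub_lt_iff]
  have h1 := dist_le_dist_add hn hx hy x.pt.2 y.pt.2 hN1
  have h2 := dist_le_dist_add (fun k hk => (hn k hk).symm) x.pt.2 y.pt.2 hx hy hN1
  have h3 : dist (⟨⟨x.pt, x.pt.2⟩⟩ : Bullseye b') ⟨⟨y.pt, y.pt.2⟩⟩ = dist x y := rfl
  constructor <;> linarith

/-- The dilations of a bounded sequence of points subconverge to a point of the limit space. -/
theorem Bullseye.exists_limit {μ : Ultrafilter ℕ} (hμ : (μ : Filter ℕ) ≤ atTop)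
    (hb : ∀ k : ℤ, ∀ᶠ n in atTop, b (k + m n) = b' k) (x : ℕ → Bullseye b) {R : ℝ}
    (hR : ∀ᶠ n in (μ : Filter ℕ), dist (x n) (origin b) / 2 ^ (m n : ℤ) ≤ R) :
    ∃ y : Bullseye b', Tendsto (fun n => dist (x n) (scaledPoint b (y.pt : E3) (m n)) /
      2 ^ (m n : ℤ)) μ (𝓝 0) := by
  set z : ℕ → E3 := fun n => (2 : ℝ) ^ (-(m n : ℤ)) • ((x n).pt : E3) with hz
  have hzS : ∀ n, z n ∈ bullseyeSet fun k => b (k + m n) :=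
    fun n => smul_mem_bullseyeSet_shift (x n).pt.2
  have hxz : ∀ n, x n = dilate (m n) ⟨⟨z n, hzS n⟩⟩ := by
    intro n
    have : (x n).pt = (dilate (m n : ℤ) ⟨⟨z n, hzS n⟩⟩).pt := by
      apply Subtype.ext
      simp [dilate, hz, smul_smul]
    exact congrArg Bullseye.mk this
  have hzn : ∀ n, ‖z n‖ = ‖((x n).pt : E3)‖ / 2 ^ (m n : ℤ) := by
    intro n
    rw [hz, norm_smul, zpow_neg, norm_inv, Real.norm_of_nonneg (zpow_two_pos _).le]
    field_simp
  have hzR : ∀ᶠ n in (μ : Filter ℕ), z n ∈ Metric.closedBall (0 : E3) R := by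
    filter_upwards [hR] with n hn
    rw [mem_closedBall_zero_iff, hzn]
    refine le_trans ?_ hn
    have := norm_pt_le (x n)
    have := zpow_two_pos (m n)
    gcongr
  obtain ⟨y, -, hy⟩ := (isCompact_closedBall (0 : E3) R).ultrafilter_le_nhds (μ.map z)
    (le_principal_iff.2 hzR)
  have hy : Tendsto z μ (𝓝 y) := hy
  -- Infinitely many pieces accumulate at the origin, so the argument by pieces fails there; the
  -- comparison of distance with norm replaces it.
  by_cases hy0 : y = 0
  · subst hy0
    refine ⟨origin b', ?_⟩
    have hlim : Tendsto (fun n => 6 * ‖z n‖) μ (𝓝 0) := by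
      simpa using hy.norm.const_mul 6
    refine squeeze_zero (fun n => div_nonneg dist_nonneg (zpow_two_pos _).le) (fun n => ?_) hlim
    rw [show ((origin b').pt : E3) = 0 from rfl, scaledPoint_zero, hzn, ← mul_div_assoc]
    have := zpow_two_pos (m n)
    gcongr
    exact dist_origin_le _
  -- all but finitely many pieces avoid a neighbourhood of the limit
  obtain ⟨k, hk1, hk2⟩ := exists_mem_Ico_zpow (norm_pos_iff.2 hy0) (one_lt_two : (1 : ℝ) < 2)
  have hl1 : (2 : ℝ) ^ (k - 1) < ‖y‖ :=
    (zpow_lt_zpow_right₀ one_lt_two (by omega)).trans_le hk1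
  have hann : ∀ᶠ n in (μ : Filter ℕ), 2 ^ (k - 1) < ‖z n‖ ∧ ‖z n‖ < 2 ^ (k + 1) :=
    (hy.norm.eventually_const_lt hl1).and (hy.norm.eventually_lt_const hk2)
  let Q : Option (Fin 4 × ℤ) → ℕ → Set E3 := fun i n => match i with
    | none => bullAxis
    | some (0, j) => bullCircle j
    | some (1, j) => bullDisc j
    | some (2, j) => bullBall j
    | some (3, j) => {p | b (j + m n) = 1 ∧ p ∈ bullBridge j}
  -- Only finitely many pieces meet the annulus around `y`, so the ultrafilter selects one that
  -- contains `z n` for `μ`-almost all `n`.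
  have hfin : ∃ i ∈ (insert none (some '' (univ ×ˢ Icc (k - 2) (k + 1))) : Set (Option (Fin 4 × ℤ))),
      ∀ᶠ n in (μ : Filter ℕ), z n ∈ Q i n := by
    rw [← Ultrafilter.eventually_exists_mem_iff]
    swap
    · exact ((finite_univ.prod (finite_Icc _ _)).image _).insert _
    filter_upwards [hann] with n hn
    have hj : ∀ j : ℤ, 2 ^ j ≤ ‖z n‖ → ‖z n‖ ≤ 2 ^ (j + 1) → j ∈ Icc (k - 2) (k + 1) := by
      intro j h1 h2
      have h3 := (zpow_lt_zpow_iff_right₀ (one_lt_two : (1 : ℝ) < 2)).1 (h1.trans_lt hn.2)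
      have h4 := (zpow_lt_zpow_iff_right₀ (one_lt_two : (1 : ℝ) < 2)).1 (hn.1.trans_le h2)
      constructor <;> omega
    rcases hzS n with h | ⟨j, h | h | h | ⟨h1, h⟩⟩
    · exact ⟨none, Or.inl rfl, h⟩
    · refine ⟨some (0, j), Or.inr ⟨_, ⟨mem_univ _, hj j h.2.ge ?_⟩, rfl⟩, h⟩
      rw [h.2]
      exact zpow_le_zpow_right₀ one_le_two (by omega)
    · exact ⟨some (1, j), Or.inr ⟨_, ⟨mem_univ _, hj j (norm_mem_of_bullDisc h).1
        (norm_mem_of_bullDisc h).2⟩, rfl⟩, h⟩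
    · exact ⟨some (2, j), Or.inr ⟨_, ⟨mem_univ _, hj j (norm_mem_of_bullBall h).1
        (norm_mem_of_bullBall h).2⟩, rfl⟩, h⟩
    · exact ⟨some (3, j), Or.inr ⟨_, ⟨mem_univ _, hj j (norm_mem_of_bullBridge h).1
        (norm_mem_of_bullBridge h).2⟩, rfl⟩, h1, h⟩
  have hpiece : ∃ P : Set E3, IsBullPiece b' P ∧ ∀ᶠ n in (μ : Filter ℕ),
      IsBullPiece (fun k => b (k + m n)) P ∧ z n ∈ P := by
    obtain ⟨i, -, hi⟩ := hfin
    match i, hi with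
    | none, hi => exact ⟨_, .axis, hi.mono fun n hn => ⟨.axis, hn⟩⟩
    | some (0, j), hi => exact ⟨_, .circle j, hi.mono fun n hn => ⟨.circle j, hn⟩⟩
    | some (1, j), hi => exact ⟨_, .disc j, hi.mono fun n hn => ⟨.disc j, hn⟩⟩
    | some (2, j), hi => exact ⟨_, .ball j, hi.mono fun n hn => ⟨.ball j, hn⟩⟩
    | some (3, j), hi =>
      -- A single index at which the bridge is present and the shifted sequence already equals `b'`
      -- at `j` shows that `b'` has this bridge.
      obtain ⟨n, hn1, hn2⟩ := (hi.and (hμ (hb j))).exists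
      exact ⟨_, .bridge j (hn2 ▸ hn1.1), hi.mono fun n hn => ⟨.bridge j hn.1, hn.2⟩⟩
  obtain ⟨P, hP, hPz⟩ := hpiece
  have hyP : y ∈ P := hP.isClosed.mem_of_tendsto hy (hPz.mono fun n hn => hn.2)
  refine ⟨⟨⟨y, hP.subset hyP⟩⟩, ?_⟩
  have hlim : Tendsto (fun n => 2 * dist (z n) y) μ (𝓝 0) := by
    simpa using (hy.dist (tendsto_const_nhds (x := y))).const_mul 2
  refine squeeze_zero' (Eventually.of_forall fun n => div_nonneg dist_nonneg (zpow_two_pos _).le)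
    ?_ hlim
  filter_upwards [hPz] with n hn
  rw [scaledPoint_of_mem (hn.1.subset hyP), hxz n, dist_dilate,
    mul_div_cancel_left₀ _ (zpow_two_pos _).ne']
  exact dist_le_of_mem_piece hn.1 (x := ⟨⟨z n, _⟩⟩) (y := ⟨⟨y, _⟩⟩) hn.2 hyP

/-- The inverse map sends `x` to the class of its dilates by `2 ^ m n`. It is isometric by
`tendsto_dist_scaledPoint` and surjective by `exists_limit`. The space `P` is only assumed isometric
to a bullseye space, so that the statement can be iterated. -/
theorem exists_cone_isometryEquiv {μ : Ultrafilter ℕ} (hμ : (μ : Filter ℕ) ≤ atTop)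
    (hb : ∀ k : ℤ, ∀ᶠ n in atTop, b (k + m n) = b' k) (P : PointedMetricSpace)
    (e : P.carrier ≃ᵢ Bullseye b) (he : e P.base = Bullseye.origin b) :
    ∃ φ : (P.cone μ fun n => 2 ^ (m n : ℤ)).carrier ≃ᵢ Bullseye b',
      φ (P.cone μ fun n => 2 ^ (m n : ℤ)).base = Bullseye.origin b' := by
  let α : ℕ → ℝ := fun n => 2 ^ (m n : ℤ)
  let s : Bullseye b' → ℕ → P.carrier := fun x n => e.symm (Bullseye.scaledPoint b (x.pt : E3) (m n))
  have hbase : s (Bullseye.origin b') = fun _ => P.base := by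
    funext n
    change e.symm (Bullseye.scaledPoint b 0 (m n)) = P.base
    rw [Bullseye.scaledPoint_zero, ← he, e.symm_apply_apply]
  have hs : ∀ x y, coneEDist μ α (s x) (s y) = ENNReal.ofReal (dist x y) := by
    intro x y
    refine coneEDist_eq_of_tendsto ?_
    simp only [s, α, e.symm.dist_eq]
    exact (Bullseye.tendsto_dist_scaledPoint hb x y).mono_left hμ
  have hadm : ∀ x, coneEDist μ α (s x) (fun _ => P.base) < ∞ := by
    intro x
    rw [← hbase, hs]
    exact ENNReal.ofReal_lt_top
  let ψ : Bullseye b' → (P.cone μ α).carrier := fun x => SeparationQuotient.mk ⟨s x, hadm x⟩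
  have hψ : Isometry ψ := by
    refine Isometry.of_dist_eq fun x y => ?_
    change (coneEDist μ α (s x) (s y)).toReal = _
    rw [hs, ENNReal.toReal_ofReal dist_nonneg]
  have hsurj : Function.Surjective ψ := by
    intro c
    obtain ⟨x, rfl⟩ := SeparationQuotient.surjective_mk c
    have hR : ∃ R : ℝ, ∀ᶠ n in (μ : Filter ℕ), dist (x.seq n) P.base / α n ≤ R := by
      refine ⟨(coneEDist μ α x.seq fun _ => P.base).toReal + 1, ?_⟩
      have h1 := (tendsto_ultraLim μ fun n =>
        ENNReal.ofReal (dist (x.seq n) P.base / α n)).eventually_lt_const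
        (ENNReal.lt_add_right x.admissible.ne one_ne_zero)
      filter_upwards [h1] with n hn
      refine (ENNReal.ofReal_le_ofReal_iff (by positivity)).1 (hn.le.trans ?_)
      rw [ENNReal.ofReal_add ENNReal.toReal_nonneg zero_le_one, ENNReal.ofReal_toReal
        x.admissible.ne, ENNReal.ofReal_one]
    obtain ⟨R, hR⟩ := hR
    obtain ⟨y, hy⟩ := Bullseye.exists_limit hμ hb (fun n => e (x.seq n)) (R := R)
      (by simpa only [← he, e.dist_eq] using hR)
    refine ⟨y, ?_⟩
    refine SeparationQuotient.mk_eq_mk.2 (Metric.inseparable_iff.2 ?_)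
    change (coneEDist μ α (s y) x.seq).toReal = 0
    rw [coneEDist_comm, coneEDist_eq_of_tendsto (c := 0), ENNReal.ofReal_zero, ENNReal.toReal_zero]
    convert hy using 2 with n
    simp only [s, α]
    rw [← e.dist_eq, e.apply_symm_apply]
  let Φ : Bullseye b' ≃ᵢ (P.cone μ α).carrier :=
    ⟨Equiv.ofBijective ψ ⟨hψ.injective, hsurj⟩, hψ⟩
  refine ⟨Φ.symm, ?_⟩
  rw [← Φ.symm_apply_apply (Bullseye.origin b')]
  congr 1
  change SeparationQuotient.mk _ = SeparationQuotient.mk _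
  congr 2
  exact hbase.symm

end BullseyeCone

/-! ### Local cut points -/

section LocalCut

/-- Some neighbourhood of `p` is separated by `p`. -/
def IsLocalCutPoint {X : Type*} [TopologicalSpace X] (p : X) : Prop :=
  ∃ U V : Set X, IsOpen U ∧ IsOpen V ∧ Disjoint U V ∧ p ∈ closure U ∧ p ∈ closure V ∧
    insert p (U ∪ V) ∈ 𝓝 p

/-- The largest open set all of whose points are local cut points. -/
def graphPart (X : Type*) [TopologicalSpace X] : Set X := interior {p | IsLocalCutPoint p}

/-- A connected component of the graph part, expressed as a relatively clopen connected subset. -/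
structure IsGraphComponent {X : Type*} [TopologicalSpace X] (K : Set X) : Prop where
  nonempty : K.Nonempty
  isPreconnected : IsPreconnected K
  isOpen : IsOpen K
  subset : K ⊆ graphPart X
  closure_inter_subset : closure K ∩ graphPart X ⊆ K

/-- Some point has arbitrarily small components of the graph part, with `n` boundary points, in its
neighbourhoods. -/
def HasSmallComponents (X : Type*) [TopologicalSpace X] (n : ℕ) : Prop :=
  ∃ x : X, ∀ V ∈ 𝓝 x, ∃ K ⊆ V, IsGraphComponent K ∧ (frontier K).ncard = n

variable {X Y : Type*} [TopologicalSpace X] [TopologicalSpace Y]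

theorem IsLocalCutPoint.map (f : X ≃ₜ Y) {p : X} (h : IsLocalCutPoint p) :
    IsLocalCutPoint (f p) := by
  obtain ⟨U, V, hU, hV, hUV, hpU, hpV, hn⟩ := h
  refine ⟨f '' U, f '' V, f.isOpen_image.2 hU, f.isOpen_image.2 hV,
    (disjoint_image_iff f.injective).2 hUV, ?_, ?_, ?_⟩
  · rw [← f.image_closure]; exact mem_image_of_mem _ hpU
  · rw [← f.image_closure]; exact mem_image_of_mem _ hpV
  · rw [← image_union, ← image_insert_eq, ← f.map_nhds_eq]
    exact image_mem_map hn

theorem isLocalCutPoint_map_iff (f : X ≃ₜ Y) {p : X} :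
    IsLocalCutPoint (f p) ↔ IsLocalCutPoint p :=
  ⟨fun h => by simpa using h.map f.symm, fun h => h.map f⟩

theorem image_graphPart (f : X ≃ₜ Y) : f '' graphPart X = graphPart Y := by
  rw [graphPart, f.image_interior]
  congr 1
  ext q
  obtain ⟨p, rfl⟩ := f.surjective q
  rw [f.injective.mem_set_image]
  exact (isLocalCutPoint_map_iff f).symm

theorem IsGraphComponent.map (f : X ≃ₜ Y) {K : Set X} (h : IsGraphComponent K) :
    IsGraphComponent (f '' K) where
  nonempty := h.nonempty.image f
  isPreconnected := h.isPreconnected.image f f.continuous.continuousOn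
  isOpen := f.isOpen_image.2 h.isOpen
  subset := by rw [← image_graphPart f]; exact image_mono h.subset
  closure_inter_subset := by
    rw [← image_graphPart f, ← f.image_closure, ← image_inter f.injective]
    exact image_mono h.closure_inter_subset

theorem HasSmallComponents.map (f : X ≃ₜ Y) {n : ℕ} (h : HasSmallComponents X n) :
    HasSmallComponents Y n := by
  obtain ⟨x, hx⟩ := h
  refine ⟨f x, fun V hV => ?_⟩
  obtain ⟨K, hKV, hK, hn⟩ := hx (f ⁻¹' V) (f.continuous.continuousAt hV)
  refine ⟨f '' K, image_subset_iff.2 hKV, hK.map f, ?_⟩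
  rw [← f.image_frontier, ncard_image_of_injective _ f.injective, hn]

/-- Within the graph part, `K` and the complement of its closure form an open partition, which a
preconnected set cannot split. -/
theorem IsGraphComponent.subset_of_isPreconnected {K L : Set X} (hK : IsGraphComponent K)
    (hL : IsPreconnected L) (hLg : L ⊆ graphPart X) (hKL : (L ∩ K).Nonempty) : L ⊆ K := by
  refine hL.subset_left_of_subset_union hK.isOpen isClosed_closure.isOpen_compl
    (disjoint_compl_right_iff_subset.2 subset_closure) (fun x hx => ?_) hKL
  by_cases h : x ∈ closure K
  · exact Or.inl (hK.closure_inter_subset ⟨h, hLg hx⟩)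
  · exact Or.inr h

theorem IsGraphComponent.eq_of_mem {K L : Set X} (hK : IsGraphComponent K)
    (hL : IsGraphComponent L) {x : X} (hxK : x ∈ K) (hxL : x ∈ L) : K = L :=
  (hL.subset_of_isPreconnected hK.isPreconnected hK.subset ⟨x, hxK, hxL⟩).antisymm
    (hK.subset_of_isPreconnected hL.isPreconnected hL.subset ⟨x, hxL, hxK⟩)

/-- Neither `U` nor `V` contains `p`, since each is open, disjoint from the other and has `p` in the
closure of the other. A small connected punctured neighbourhood would meet both while being covered
by them. -/
theorem not_isLocalCutPoint_of_basis {p : X}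
    (h : ∀ W ∈ 𝓝 p, ∃ W' ⊆ W, IsOpen W' ∧ p ∈ W' ∧ IsPreconnected (W' \ {p})) :
    ¬ IsLocalCutPoint p := by
  rintro ⟨U, V, hU, hV, hUV, hpU, hpV, hn⟩
  obtain ⟨W, hW, hWo, hpW, hWc⟩ := h _ hn
  have hpU' : p ∉ U := fun h => by
    obtain ⟨q, hq1, hq2⟩ := mem_closure_iff.1 hpV U hU h
    exact hUV.le_bot ⟨hq1, hq2⟩
  have hpV' : p ∉ V := fun h => by
    obtain ⟨q, hq1, hq2⟩ := mem_closure_iff.1 hpU V hV h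
    exact hUV.le_bot ⟨hq2, hq1⟩
  obtain ⟨u, hu1, hu2⟩ := mem_closure_iff.1 hpU W hWo hpW
  obtain ⟨v, hv1, hv2⟩ := mem_closure_iff.1 hpV W hWo hpW
  have hsub : W \ {p} ⊆ U := by
    refine hWc.subset_left_of_subset_union hU hV hUV (fun q hq => ?_)
      ⟨u, ⟨hu1, fun h => hpU' (h ▸ hu2)⟩, hu2⟩
    exact (hW hq.1).resolve_left hq.2
  exact hUV.le_bot ⟨hsub ⟨hv1, fun h => hpV' (h ▸ hv2)⟩, hv2⟩

/-- The ball is homeomorphic to the whole space with its centre at the origin, and a punctured space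
of dimension at least two is connected. -/
theorem isPreconnected_ball_diff_singleton {F : Type*} [NormedAddCommGroup F] [NormedSpace ℝ F]
    (hF : 1 < Module.rank ℝ F) (x : F) {r : ℝ} (hr : 0 < r) :
    IsPreconnected (Metric.ball x r \ {x}) := by
  have h1 := (isConnected_compl_singleton_of_one_lt_rank hF (0 : F)).isPreconnected
  have h2 := h1.image _ (OpenPartialHomeomorph.continuous_univBall x r).continuousOn
  have h3 : OpenPartialHomeomorph.univBall x r '' {0}ᶜ = Metric.ball x r \ {x} := by
    have hinj := (OpenPartialHomeomorph.univBall x r).injOn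
    rw [OpenPartialHomeomorph.univBall_source] at hinj
    rw [compl_eq_univ_sdiff, hinj.image_sdiff_subset (subset_univ _), image_singleton,
      OpenPartialHomeomorph.univBall_apply_zero]
    congr 1
    have := (OpenPartialHomeomorph.univBall x r).image_source_eq_target
    rwa [OpenPartialHomeomorph.univBall_source, OpenPartialHomeomorph.univBall_target _ hr] at this
  rwa [h3] at h2

end LocalCut

theorem isPreconnected_E3_ball_diff_singleton (p : E3) {r : ℝ} (hr : 0 < r) :
    IsPreconnected (Metric.ball p r \ {p}) :=
  isPreconnected_ball_diff_singleton (by rw [← Module.finrank_eq_rank]; simp) p hr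

theorem isPreconnected_plane_ball_diff_singleton {p : E3} (hp : p 2 = 0) {r : ℝ} (hr : 0 < r) :
    IsPreconnected ({q : E3 | q 2 = 0} ∩ (Metric.ball p r \ {p})) := by
  let ι : EuclideanSpace ℝ (Fin 2) → E3 := fun u => !₂[u 0, u 1, 0]
  have hι : Isometry ι := by
    refine Isometry.of_dist_eq fun u v => ?_
    simp [ι, EuclideanSpace.dist_eq, Fin.sum_univ_succ]
  have hιs : ∀ q : E3, q 2 = 0 → ι !₂[q 0, q 1] = q := fun q hq =>
    E3_ext rfl rfl hq.symm
  have h := (isPreconnected_ball_diff_singleton (F := EuclideanSpace ℝ (Fin 2))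
    (by rw [← Module.finrank_eq_rank]; simp) !₂[p 0, p 1] hr).image ι hι.continuous.continuousOn
  convert h using 1
  ext q
  constructor
  · rintro ⟨h2, h3, h4⟩
    refine ⟨!₂[q 0, q 1], ⟨?_, fun h => h4 ?_⟩, hιs q h2⟩
    · rw [Metric.mem_ball, ← hι.dist_eq, hιs q h2, hιs p hp]
      exact h3
    · rw [mem_singleton_iff] at h ⊢
      rw [← hιs q h2, h, hιs p hp]
  · rintro ⟨u, ⟨h3, h4⟩, rfl⟩
    refine ⟨rfl, ?_, fun h => h4 ?_⟩
    · rw [← hιs p hp, Metric.mem_ball, hι.dist_eq]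
      exact h3
    · rw [mem_singleton_iff] at h ⊢
      rw [← hιs p hp] at h
      exact hι.injective h

/-! ### Coordinates of the pieces -/

theorem mem_bullDisc_iff {k : ℤ} {p : E3} : p ∈ bullDisc k ↔
    p 2 = 0 ∧ (p 0 - 3 / 2 * 2 ^ k) ^ 2 + p 1 ^ 2 + p 2 ^ 2 ≤ (2 ^ k / 2) ^ 2 := by
  have h := E3_norm_sq (p - !₂[3 / 2 * 2 ^ k, 0, 0])
  simp only [PiLp.sub_apply] at h
  change p 2 = 0 ∧ dist p _ ≤ _ ↔ _
  rw [dist_eq_norm, ← sq_le_sq₀ (norm_nonneg _) (by positivity), h]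
  simp

theorem mem_bullBall_iff {k : ℤ} {p : E3} : p ∈ bullBall k ↔
    (p 0 + 3 / 2 * 2 ^ k) ^ 2 + p 1 ^ 2 + p 2 ^ 2 ≤ (2 ^ k / 2) ^ 2 := by
  have h := E3_norm_sq (p - !₂[-(3 / 2 * 2 ^ k), 0, 0])
  simp only [PiLp.sub_apply] at h
  change dist p _ ≤ _ ↔ _
  rw [dist_eq_norm, ← sq_le_sq₀ (norm_nonneg _) (by positivity), h]
  simp

theorem le_of_mem_bullDisc {k : ℤ} {p : E3} (hp : p ∈ bullDisc k) : 2 ^ k ≤ p 0 := by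
  have h := (mem_bullDisc_iff.1 hp).2
  nlinarith [sq_nonneg (p 1), sq_nonneg (p 2), zpow_two_pos k]

theorem le_of_mem_bullBall {k : ℤ} {p : E3} (hp : p ∈ bullBall k) : p 0 ≤ -2 ^ k := by
  have h := mem_bullBall_iff.1 hp
  nlinarith [sq_nonneg (p 1), sq_nonneg (p 2), zpow_two_pos k]

theorem zpow_two_lt_iff {i j : ℤ} : (2 : ℝ) ^ i < 2 ^ j ↔ i < j :=
  zpow_lt_zpow_iff_right₀ one_lt_two

theorem zpow_two_le_iff {i j : ℤ} : (2 : ℝ) ^ i ≤ 2 ^ j ↔ i ≤ j :=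
  zpow_le_zpow_iff_right₀ one_lt_two

theorem norm_eq_cases {k j : ℤ} (h1 : (2 : ℝ) ^ k ≤ 2 ^ j) (h2 : (2 : ℝ) ^ j ≤ 2 ^ (k + 1)) :
    j = k ∨ j = k + 1 := by
  rw [zpow_two_le_iff] at h1 h2
  omega

/-- The disc lies between the circles of radii `2 ^ k` and `2 ^ (k + 1)` and is tangent to each at a
point of the axis. -/
theorem bullDisc_inter_bullCircle {k j : ℤ} {p : E3} (hp : p ∈ bullDisc k)
    (hj : p ∈ bullCircle j) : p 1 = 0 := by
  obtain ⟨h1, h2⟩ := norm_mem_of_bullDisc hp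
  have h3 := (mem_bullDisc_iff.1 hp).2
  have h4 := E3_norm_sq p
  have h0 := le_of_mem_bullDisc hp
  have hk := zpow_two_pos k
  rw [hj.2] at h1 h2 h4
  refine pow_eq_zero_iff two_ne_zero |>.1 (le_antisymm ?_ (sq_nonneg _))
  rcases norm_eq_cases h1 h2 with rfl | rfl
  · nlinarith [sq_nonneg (p 2)]
  · rw [zpow_two_succ] at h4
    have h5 : 2 * 2 ^ k ≤ p 0 := by nlinarith [sq_nonneg (p 2)]
    nlinarith [sq_nonneg (p 2)]

theorem bullBall_inter_bullCircle {k j : ℤ} {p : E3} (hp : p ∈ bullBall k)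
    (hj : p ∈ bullCircle j) : p 1 = 0 := by
  obtain ⟨h1, h2⟩ := norm_mem_of_bullBall hp
  have h3 := mem_bullBall_iff.1 hp
  have h4 := E3_norm_sq p
  have h0 := le_of_mem_bullBall hp
  have hk := zpow_two_pos k
  rw [hj.2] at h1 h2 h4
  refine pow_eq_zero_iff two_ne_zero |>.1 (le_antisymm ?_ (sq_nonneg _))
  rcases norm_eq_cases h1 h2 with rfl | rfl
  · nlinarith [sq_nonneg (p 2)]
  · rw [zpow_two_succ] at h4
    have h5 : p 0 ≤ -(2 * 2 ^ k) := by nlinarith [sq_nonneg (p 2)]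
    nlinarith [sq_nonneg (p 2)]

/-- Discs and balls cover the axis apart from the origin, so axis points need no separate treatment
elsewhere. -/
theorem exists_mem_bullDisc_of_axis {p : E3} (hp : p ∈ bullAxis) (h0 : 0 < p 0) :
    ∃ k, p ∈ bullDisc k := by
  obtain ⟨k, hk1, hk2⟩ := exists_mem_Ico_zpow h0 (one_lt_two : (1 : ℝ) < 2)
  refine ⟨k, mem_bullDisc_iff.2 ⟨hp.2, ?_⟩⟩
  rw [hp.1, hp.2]
  rw [zpow_two_succ] at hk2
  nlinarith

theorem exists_mem_bullBall_of_axis {p : E3} (hp : p ∈ bullAxis) (h0 : p 0 < 0) :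
    ∃ k, p ∈ bullBall k := by
  obtain ⟨k, hk1, hk2⟩ := exists_mem_Ico_zpow (neg_pos.2 h0) (one_lt_two : (1 : ℝ) < 2)
  refine ⟨k, mem_bullBall_iff.2 ?_⟩
  rw [hp.1, hp.2]
  rw [zpow_two_succ] at hk2
  nlinarith

/-! ### Transfer of points and continuous maps from three-space. -/

namespace Bullseye

variable {a : ℤ → Fin 2}

open Classical in
/-- The point `p` of three-space, as a point of the bullseye space to which it belongs. -/
noncomputable def ofPoint (a : ℤ → Fin 2) (p : E3) : Bullseye a :=
  if h : p ∈ bullseyeSet a then ⟨⟨p, h⟩⟩ else origin a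

theorem pt_ofPoint {p : E3} (h : p ∈ bullseyeSet a) : ((ofPoint a p).pt : E3) = p := by
  rw [ofPoint, dif_pos h]

@[simp] theorem ofPoint_pt (x : Bullseye a) : ofPoint a (x.pt : E3) = x := dif_pos x.pt.2

theorem ext_pt {x y : Bullseye a} (h : (x.pt : E3) = y.pt) : x = y := by
  rw [← ofPoint_pt x, h, ofPoint_pt]

theorem dist_ofPoint_le {C : Set E3} (hC : Convex ℝ C) (hCS : C ⊆ bullseyeSet a) {p q : E3}
    (hp : p ∈ C) (hq : q ∈ C) : dist (ofPoint a p) (ofPoint a q) ≤ dist p q := by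
  have h := dist_le_of_segment (x := ofPoint a p) (y := ofPoint a q)
  rw [pt_ofPoint (hCS hp), pt_ofPoint (hCS hq)] at h
  exact h ((hC.segment_subset hp hq).trans hCS)

theorem continuousOn_ofPoint {C : Set E3} (hC : Convex ℝ C) (hCS : C ⊆ bullseyeSet a) :
    ContinuousOn (ofPoint a) C :=
  (LipschitzOnWith.of_dist_le_mul (K := 1) fun p hp q hq => by
    simpa using dist_ofPoint_le hC hCS hp hq).continuousOn

theorem bullArc_mem (a : ℤ → Fin 2) (k : ℤ) (θ : ℝ) : bullArc k θ ∈ bullseyeSet a :=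
  (IsBullPiece.circle k).subset (bullArc_mem_bullCircle k θ)

theorem continuous_ofPoint_bullArc (a : ℤ → Fin 2) (k : ℤ) :
    Continuous fun θ => ofPoint a (bullArc k θ) := by
  refine (LipschitzWith.of_dist_le_mul (K := 2 ^ k) fun θ φ => ?_).continuous
  push_cast
  have key : ∀ θ φ : ℝ, θ ≤ φ → dist (ofPoint a (bullArc k θ)) (ofPoint a (bullArc k φ)) ≤
      2 ^ k * dist θ φ := fun θ φ h => by
    rw [dist_comm θ, Real.dist_eq, abs_of_nonneg (sub_nonneg.2 h)]
    exact dist_le_of_bullArc h _ _ (pt_ofPoint (bullArc_mem a k _)).symm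
      (pt_ofPoint (bullArc_mem a k _)).symm
  rcases le_total θ φ with h | h
  · exact key θ φ h
  · rw [dist_comm, dist_comm θ]
    exact key φ θ h

theorem continuous_coord (i : Fin 3) : Continuous fun x : Bullseye a => (x.pt : E3) i :=
  (continuous_E3_apply i).comp continuous_pt

theorem continuous_norm_pt : Continuous fun x : Bullseye a => ‖(x.pt : E3)‖ :=
  continuous_norm.comp continuous_pt

/-! ### The thin part of a bullseye space -/

/-- The complement of the axis, the discs and the balls. -/
def thin (a : ℤ → Fin 2) : Set (Bullseye a) :=
  {x | (x.pt : E3) ∉ bullAxis ∧ ∀ k, (x.pt : E3) ∉ bullDisc k ∧ (x.pt : E3) ∉ bullBall k}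

/-- Endpoints of a bridge are counted as points of circles, so that the second alternative is an
open bridge. -/
theorem thin_cases {x : Bullseye a} (hx : x ∈ thin a) :
    (x.pt : E3) 1 ≠ 0 ∧ ∃ k, (x.pt : E3) ∈ bullCircle k ∨
      (a k = 1 ∧ (x.pt : E3) ∈ bullBridge k ∧ 2 ^ k < ‖(x.pt : E3)‖ ∧ ‖(x.pt : E3)‖ < 2 ^ (k + 1)) := by
  obtain ⟨h1, h2⟩ := hx
  have hk : ∃ k, (x.pt : E3) ∈ bullCircle k ∨
      (a k = 1 ∧ (x.pt : E3) ∈ bullBridge k ∧ 2 ^ k < ‖(x.pt : E3)‖ ∧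
        ‖(x.pt : E3)‖ < 2 ^ (k + 1)) := by
    rcases x.pt.2 with h | ⟨k, h | h | h | ⟨hk, h⟩⟩
    · exact absurd h h1
    · exact ⟨k, Or.inl h⟩
    · exact absurd h (h2 k).1
    · exact absurd h (h2 k).2
    · obtain ⟨h3, h4⟩ := norm_mem_of_bullBridge h
      rcases h3.eq_or_lt with h5 | h5
      · exact ⟨k, Or.inl ⟨h.2.1, h5.symm⟩⟩
      · rcases h4.eq_or_lt with h6 | h6
        · exact ⟨k + 1, Or.inl ⟨h.2.1, h6⟩⟩
        · exact ⟨k, Or.inr ⟨hk, h, h5, h6⟩⟩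
  refine ⟨fun h => h1 ⟨h, ?_⟩, hk⟩
  obtain ⟨k, h3 | h3⟩ := hk
  · exact h3.1
  · exact h3.2.1.2.1

theorem mem_thin_of_circle {x : Bullseye a} {k : ℤ} (hx : (x.pt : E3) ∈ bullCircle k)
    (h1 : (x.pt : E3) 1 ≠ 0) : x ∈ thin a :=
  ⟨fun h => h1 h.1, fun _ => ⟨fun h => h1 (bullDisc_inter_bullCircle h hx),
    fun h => h1 (bullBall_inter_bullCircle h hx)⟩⟩

theorem mem_thin_of_coord {x : Bullseye a} (h0 : (x.pt : E3) 0 = 0)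
    (h1 : (x.pt : E3) 1 ≠ 0) : x ∈ thin a := by
  refine ⟨fun h => h1 h.1, fun k => ⟨fun h => ?_, fun h => ?_⟩⟩
  · have := le_of_mem_bullDisc h
    linarith [zpow_two_pos k]
  · have := le_of_mem_bullBall h
    linarith [zpow_two_pos k]

/-- Away from the origin the discs and balls are locally finite: near `x`, only those of index `k -
1` and `k` can occur. -/
theorem isOpen_thin (a : ℤ → Fin 2) : IsOpen (thin a) := by
  refine isOpen_iff_mem_nhds.2 fun x hx => ?_
  have h1 := (thin_cases hx).1
  have hx0 : 0 < ‖(x.pt : E3)‖ := norm_pos_iff.2 fun h => h1 (by rw [h]; rfl)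
  obtain ⟨k, hk1, hk2⟩ := exists_mem_Ico_zpow hx0 (one_lt_two : (1 : ℝ) < 2)
  have hk0 : (2 : ℝ) ^ (k - 1) < ‖(x.pt : E3)‖ :=
    (zpow_two_lt_iff.2 (by omega)).trans_le hk1
  have hc : ∀ C : Set E3, IsClosed C → (x.pt : E3) ∉ C →
      ∀ᶠ y : Bullseye a in 𝓝 x, (y.pt : E3) ∉ C := fun C hC hxC =>
    continuous_pt.continuousAt (hC.isOpen_compl.mem_nhds hxC)
  filter_upwards [hc _ isClosed_bullAxis hx.1, hc _ (isClosed_bullDisc (k - 1)) (hx.2 _).1,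
    hc _ (isClosed_bullDisc k) (hx.2 _).1, hc _ (isClosed_bullBall (k - 1)) (hx.2 _).2,
    hc _ (isClosed_bullBall k) (hx.2 _).2,
    continuous_norm_pt.continuousAt.eventually_const_lt hk0,
    continuous_norm_pt.continuousAt.eventually_lt_const hk2] with y e1 e2 e3 e4 e5 e6 e7
  have key : ∀ j : ℤ, 2 ^ j ≤ ‖(y.pt : E3)‖ → ‖(y.pt : E3)‖ ≤ 2 ^ (j + 1) → j = k - 1 ∨ j = k := by
    intro j h3 h4
    have h5 := zpow_two_lt_iff.1 (h3.trans_lt e7)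
    have h6 := zpow_two_lt_iff.1 (e6.trans_le h4)
    omega
  refine ⟨e1, fun j => ⟨fun h => ?_, fun h => ?_⟩⟩
  · obtain ⟨h3, h4⟩ := norm_mem_of_bullDisc h
    rcases key j h3 h4 with rfl | rfl
    · exact e2 h
    · exact e3 h
  · obtain ⟨h3, h4⟩ := norm_mem_of_bullBall h
    rcases key j h3 h4 with rfl | rfl
    · exact e4 h
    · exact e5 h

/-- Near an interior point of a bridge the space is an interval, cut by comparing the second
coordinate. -/
theorem isLocalCutPoint_of_bridge {x : Bullseye a} {k : ℤ} (hk : a k = 1)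
    (hx : (x.pt : E3) ∈ bullBridge k) (h1 : 2 ^ k < ‖(x.pt : E3)‖)
    (h2 : ‖(x.pt : E3)‖ < 2 ^ (k + 1)) : IsLocalCutPoint x := by
  have hxt : x ∈ thin a := mem_thin_of_coord hx.1 (by
    rw [← norm_eq_of_bullBridge hx]; exact ((zpow_two_pos k).trans h1).ne')
  have hxn := norm_eq_of_bullBridge hx
  let N : Set (Bullseye a) := {y | y ∈ thin a ∧ 2 ^ k < ‖(y.pt : E3)‖ ∧ ‖(y.pt : E3)‖ < 2 ^ (k + 1)}
  have hN : IsOpen N := (isOpen_thin a).inter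
    ((isOpen_lt continuous_const continuous_norm_pt).inter
      (isOpen_lt continuous_norm_pt continuous_const))
  have hNb : ∀ y ∈ N, (y.pt : E3) ∈ bullBridge k := by
    rintro y ⟨hy, h3, h4⟩
    obtain ⟨-, j, h5 | ⟨-, h5, h6, h7⟩⟩ := thin_cases hy
    · rw [h5.2, zpow_two_lt_iff] at h3 h4
      omega
    · have h8 := zpow_two_lt_iff.1 (h3.trans h7)
      have h9 := zpow_two_lt_iff.1 (h6.trans h4)
      rwa [show k = j by omega]
  let c : ℝ → Bullseye a := fun t => ofPoint a !₂[0, (x.pt : E3) 1 + t, 0]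
  have hcb : ∀ᶠ t in 𝓝 (0 : ℝ), (!₂[0, (x.pt : E3) 1 + t, 0] : E3) ∈ bullBridge k := by
    have e1 : ∀ᶠ t in 𝓝 (0 : ℝ), 2 ^ k < (x.pt : E3) 1 + t :=
      (Continuous.tendsto' (by fun_prop) 0 _ (add_zero _)).eventually_const_lt (hxn ▸ h1)
    have e2 : ∀ᶠ t in 𝓝 (0 : ℝ), (x.pt : E3) 1 + t < 2 ^ (k + 1) :=
      (Continuous.tendsto' (by fun_prop) 0 _ (add_zero _)).eventually_lt_const (hxn ▸ h2)
    filter_upwards [e1, e2] with t h3 h4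
    exact ⟨by simp, by simp, by simpa using h3.le, by simpa using h4.le⟩
  have hc0 : c 0 = x := by
    have h : (!₂[0, (x.pt : E3) 1 + 0, 0] : E3) = x.pt :=
      E3_ext hx.1.symm (add_zero _) hx.2.1.symm
    simp only [c, h, ofPoint_pt]
  have hc : Tendsto c (𝓝 0) (𝓝 x) := by
    rw [tendsto_iff_dist_tendsto_zero]
    have hlim : Tendsto (fun t : ℝ => |t|) (𝓝 0) (𝓝 0) := by
      simpa using (continuous_abs.tendsto (0 : ℝ))
    refine squeeze_zero' (Eventually.of_forall fun _ => dist_nonneg) ?_ hlim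
    filter_upwards [hcb] with t ht
    rw [← ofPoint_pt x]
    refine (dist_ofPoint_le (convex_bullBridge k) (IsBullPiece.bridge k hk).subset ht hx).trans ?_
    refine (sq_le_sq₀ dist_nonneg (abs_nonneg _)).1 ?_
    rw [dist_eq_norm, E3_norm_sq]
    simp [hx.1, hx.2.1]
  have hcN : ∀ᶠ t in 𝓝 (0 : ℝ), c t ∈ N :=
    hc (hN.mem_nhds ⟨hxt, h1, h2⟩)
  have hcpt : ∀ᶠ t in 𝓝 (0 : ℝ), ((c t).pt : E3) 1 = (x.pt : E3) 1 + t := by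
    filter_upwards [hcb] with t ht
    simp only [c]
    rw [pt_ofPoint ((IsBullPiece.bridge k hk).subset ht)]
    simp
  refine ⟨N ∩ {y | (y.pt : E3) 1 < (x.pt : E3) 1}, N ∩ {y | (x.pt : E3) 1 < (y.pt : E3) 1},
    hN.inter (isOpen_lt (continuous_coord 1) continuous_const),
    hN.inter (isOpen_lt continuous_const (continuous_coord 1)), ?_, ?_, ?_, ?_⟩
  · rw [disjoint_left]
    intro y h3 h4
    simp only [mem_inter_iff, mem_ofPred_eq] at h3 h4
    linarith [h3.2, h4.2]
  · refine mem_closure_of_tendsto (hc.mono_left nhdsWithin_le_nhds : Tendsto c (𝓝[<] 0) _) ?_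
    filter_upwards [nhdsWithin_le_nhds hcN, nhdsWithin_le_nhds hcpt, self_mem_nhdsWithin]
      with t h3 h4 h5
    have h5' : t < 0 := h5
    exact ⟨h3, by simp only [mem_ofPred_eq, h4]; linarith⟩
  · refine mem_closure_of_tendsto (hc.mono_left nhdsWithin_le_nhds : Tendsto c (𝓝[>] 0) _) ?_
    filter_upwards [nhdsWithin_le_nhds hcN, nhdsWithin_le_nhds hcpt, self_mem_nhdsWithin]
      with t h3 h4 h5
    have h5' : 0 < t := h5
    exact ⟨h3, by simp only [mem_ofPred_eq, h4]; linarith⟩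
  · filter_upwards [hN.mem_nhds ⟨hxt, h1, h2⟩] with y hy
    rcases lt_trichotomy ((y.pt : E3) 1) ((x.pt : E3) 1) with h | h | h
    · exact Or.inr (Or.inl ⟨hy, h⟩)
    · have hyb := hNb y hy
      exact Or.inl (ext_pt (E3_ext (hyb.1.trans hx.1.symm) h (hyb.2.1.trans hx.2.1.symm)))
    · exact Or.inr (Or.inr ⟨hy, h⟩)

/-- Cosine is strictly monotone near `θ`; multiplying by `sin θ` treats the upper and lower half
circles together. -/
theorem eventually_cos_add {θ : ℝ} (hθ : Real.sin θ ≠ 0) :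
    ∀ᶠ t in 𝓝 (0 : ℝ), (0 < Real.sin θ * t → Real.cos (θ + t) < Real.cos θ) ∧
      (Real.sin θ * t < 0 → Real.cos θ < Real.cos (θ + t)) := by
  have e1 : ∀ᶠ t in 𝓝 (0 : ℝ), 0 < Real.sin θ * Real.sin (θ + t / 2) :=
    (Continuous.tendsto' (by fun_prop) 0 (Real.sin θ * Real.sin θ) (by simp)).eventually_const_lt
      (mul_self_pos.2 hθ)
  have e2 : ∀ᶠ t in 𝓝 (0 : ℝ), |t| < 1 :=
    (Continuous.tendsto' (by fun_prop) 0 0 (by simp)).eventually_lt_const one_pos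
  filter_upwards [e1, e2] with t h1 h2
  rw [abs_lt] at h2
  have hpi := Real.pi_gt_three
  have hid : Real.cos (θ + t) - Real.cos θ = -2 * Real.sin (θ + t / 2) * Real.sin (t / 2) := by
    rw [Real.cos_sub_cos]
    ring_nf
  have hs : 0 < t → 0 < Real.sin (t / 2) := fun h =>
    Real.sin_pos_of_pos_of_lt_pi (by linarith) (by linarith)
  have hs' : t < 0 → Real.sin (t / 2) < 0 := fun h =>
    Real.sin_neg_of_neg_of_neg_pi_lt (by linarith) (by linarith)
  rcases lt_or_gt_of_ne hθ with h | h
  · have h3 : Real.sin (θ + t / 2) < 0 := by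
      by_contra! h4
      nlinarith
    constructor
    · intro h4
      have := hs' (by by_contra! h5; nlinarith)
      nlinarith
    · intro h4
      have := hs (by by_contra! h5; nlinarith)
      nlinarith
  · have h3 : 0 < Real.sin (θ + t / 2) := by
      by_contra! h4
      nlinarith
    constructor
    · intro h4
      have := hs (by by_contra! h5; nlinarith)
      nlinarith
    · intro h4
      have := hs' (by by_contra! h5; nlinarith)
      nlinarith

theorem frequently_mul_pos {c : ℝ} (hc : c ≠ 0) : ∃ᶠ t in 𝓝 (0 : ℝ), 0 < c * t := by
  have h : Tendsto (fun s : ℝ => c * s) (𝓝[>] 0) (𝓝 0) := by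
    have : Tendsto (fun s : ℝ => c * s) (𝓝 0) (𝓝 (c * 0)) := by
      exact (continuous_const_mul c).tendsto 0
    rw [mul_zero] at this
    exact this.mono_left nhdsWithin_le_nhds
  refine h.frequently (Eventually.frequently ?_)
  filter_upwards [self_mem_nhdsWithin] with s hs
  have hs' : 0 < s := hs
  rw [← mul_assoc]
  exact mul_pos (mul_self_pos.2 hc) hs'

theorem isLocalCutPoint_of_circle {x : Bullseye a} {k : ℤ} (hx : (x.pt : E3) ∈ bullCircle k)
    (h1 : (x.pt : E3) 1 ≠ 0) : IsLocalCutPoint x := by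
  obtain ⟨θ, -, -, hθ⟩ := exists_bullArc_eq hx
  have hsin : Real.sin θ ≠ 0 := by
    intro h
    rw [← hθ, bullArc_one, h, mul_zero] at h1
    exact h1 rfl
  -- The choice of `δ` makes the neighbourhood miss the bridges, unless `x` itself lies on the
  -- `y`-axis.
  obtain ⟨δ, hδ0, hδ⟩ : ∃ δ > 0, |0 - (x.pt : E3) 0| < δ → (x.pt : E3) 0 = 0 := by
    by_cases h0 : (x.pt : E3) 0 = 0
    · exact ⟨1, one_pos, fun _ => h0⟩
    · exact ⟨|(x.pt : E3) 0|, abs_pos.2 h0, fun h => by simp at h⟩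
  let N : Set (Bullseye a) := {y | y ∈ thin a ∧ 2 ^ (k - 1) < ‖(y.pt : E3)‖ ∧
    ‖(y.pt : E3)‖ < 2 ^ (k + 1) ∧ 0 < (y.pt : E3) 1 * (x.pt : E3) 1 ∧
    |(y.pt : E3) 0 - (x.pt : E3) 0| < δ}
  have hN : IsOpen N := (isOpen_thin a).inter
    ((isOpen_lt continuous_const continuous_norm_pt).inter
      ((isOpen_lt continuous_norm_pt continuous_const).inter
      ((isOpen_lt continuous_const ((continuous_coord 1).mul continuous_const)).inter
      (isOpen_lt ((continuous_coord 0).sub continuous_const).abs continuous_const))))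
  have hxN : x ∈ N := by
    refine ⟨mem_thin_of_circle hx h1, ?_, ?_, mul_self_pos.2 h1, by simpa using hδ0⟩
    · rw [hx.2, zpow_two_lt_iff]; omega
    · rw [hx.2, zpow_two_lt_iff]; omega
  -- On the circle `g` is the difference of first coordinates. At a junction, where `x` is on the
  -- `y`-axis, the extra term puts any attached bridges on the positive side, so two sides suffice
  -- although up to four arcs meet there.
  let g : Bullseye a → ℝ := fun y => (y.pt : E3) 0 - (x.pt : E3) 0 + |‖(y.pt : E3)‖ - 2 ^ k|
  have hg : Continuous g :=
    ((continuous_coord 0).sub continuous_const).add (continuous_norm_pt.sub continuous_const).abs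
  have hg0 : ∀ y ∈ N, g y = 0 → y = x := by
    rintro y ⟨hy, h2, h3, h4, h5⟩ h6
    obtain ⟨-, j, h7 | ⟨-, h7, h8, h9⟩⟩ := thin_cases hy
    · have hjk : j = k := by
        rw [h7.2, zpow_two_lt_iff] at h2 h3
        omega
      subst hjk
      have h8 : (y.pt : E3) 0 = (x.pt : E3) 0 := by
        simp only [g, h7.2, sub_self, abs_zero, add_zero] at h6
        linarith
      have h9 : (y.pt : E3) 2 = (x.pt : E3) 2 := h7.1.trans hx.1.symm
      have h10 := E3_norm_sq (y.pt : E3)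
      have h11 := E3_norm_sq (x.pt : E3)
      rw [h7.2, h8, h9] at h10
      rw [hx.2] at h11
      have h12 : (y.pt : E3) 1 ^ 2 = (x.pt : E3) 1 ^ 2 := by linarith
      refine ext_pt (E3_ext h8 ?_ h9)
      rcases sq_eq_sq_iff_eq_or_eq_neg.1 h12 with h | h
      · exact h
      · rw [h] at h4
        nlinarith [sq_nonneg ((x.pt : E3) 1)]
    · rw [h7.1] at h5
      have h10 := hδ h5
      simp only [g, h7.1, h10, sub_self, zero_add, abs_eq_zero, sub_eq_zero] at h6
      rw [h6, zpow_two_lt_iff] at h8 h9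
      omega
  let c : ℝ → Bullseye a := fun t => ofPoint a (bullArc k (θ + t))
  have hc : Tendsto c (𝓝 0) (𝓝 x) := by
    have h2 : Continuous c := (continuous_ofPoint_bullArc a k).comp (continuous_const_add θ)
    have h3 : c 0 = x := by
      simp only [c, add_zero, hθ, ofPoint_pt]
    rw [← h3]
    exact h2.tendsto 0
  have hcN := hc (hN.mem_nhds hxN)
  have hcg : ∀ t, g (c t) = 2 ^ k * (Real.cos (θ + t) - Real.cos θ) := by
    intro t
    simp only [g, c, pt_ofPoint (bullArc_mem a k _), ← hθ, norm_bullArc, bullArc_zero, sub_self,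
      abs_zero]
    ring
  have hk := zpow_two_pos k
  refine ⟨N ∩ {y | g y < 0}, N ∩ {y | 0 < g y}, hN.inter (isOpen_lt hg continuous_const),
    hN.inter (isOpen_lt continuous_const hg), ?_, ?_, ?_, ?_⟩
  · rw [disjoint_left]
    intro y h3 h4
    simp only [mem_inter_iff, mem_ofPred_eq] at h3 h4
    linarith [h3.2, h4.2]
  · refine mem_closure_of_frequently_of_tendsto ?_ hc
    refine ((frequently_mul_pos hsin).and_eventually
      ((eventually_cos_add hsin).and hcN)).mono ?_
    rintro t ⟨h3, h4, h5⟩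
    refine ⟨h5, ?_⟩
    rw [mem_ofPred_eq, hcg]
    exact mul_neg_of_pos_of_neg hk (sub_neg.2 (h4.1 h3))
  · refine mem_closure_of_frequently_of_tendsto ?_ hc
    refine ((frequently_mul_pos (neg_ne_zero.2 hsin)).and_eventually
      ((eventually_cos_add hsin).and hcN)).mono ?_
    rintro t ⟨h3, h4, h5⟩
    refine ⟨h5, ?_⟩
    rw [mem_ofPred_eq, hcg]
    exact mul_pos hk (sub_pos.2 (h4.2 (by linarith)))
  · filter_upwards [hN.mem_nhds hxN] with y hy
    rcases lt_trichotomy (g y) 0 with h | h | h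
    · exact Or.inr (Or.inl ⟨hy, h⟩)
    · exact Or.inl (hg0 y hy h)
    · exact Or.inr (Or.inr ⟨hy, h⟩)

theorem thin_subset_graphPart (a : ℤ → Fin 2) : thin a ⊆ graphPart (Bullseye a) := by
  refine interior_maximal (fun x hx => ?_) (isOpen_thin a)
  obtain ⟨h1, k, h2 | ⟨h2, h3, h4, h5⟩⟩ := thin_cases hx
  · exact isLocalCutPoint_of_circle h2 h1
  · exact isLocalCutPoint_of_bridge h2 h3 h4 h5

/-- Inside a convex piece small balls of the path metric are Euclidean ones, so connectedness of
punctured balls carries over. -/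
theorem not_isLocalCutPoint_of_convex {x : Bullseye a} {P : Set E3} (hP : IsBullPiece a P)
    (hPc : Convex ℝ P) (hx : (x.pt : E3) ∈ P) (hN : ∀ᶠ y : Bullseye a in 𝓝 x, (y.pt : E3) ∈ P)
    {ρ : ℝ} (hρ : 0 < ρ)
    (hball : ∀ r, 0 < r → r ≤ ρ → IsPreconnected (P ∩ (Metric.ball (x.pt : E3) r \ {(x.pt : E3)}))) :
    ¬ IsLocalCutPoint x := by
  refine not_isLocalCutPoint_of_basis fun W hW => ?_
  obtain ⟨ε, hε, hεW⟩ := Metric.mem_nhds_iff.1 (inter_mem hW hN)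
  have hr : 0 < min ε ρ := lt_min hε hρ
  have hsub : Metric.ball x (min ε ρ) ⊆ Metric.ball x ε := Metric.ball_subset_ball (min_le_left _ _)
  refine ⟨Metric.ball x (min ε ρ), fun y hy => (hεW (hsub hy)).1, Metric.isOpen_ball,
    Metric.mem_ball_self hr, ?_⟩
  convert (hball _ hr (min_le_right _ _)).image (ofPoint a)
    ((continuousOn_ofPoint hPc hP.subset).mono inter_subset_left) using 1
  ext y
  constructor
  · rintro ⟨h1, h2⟩
    refine ⟨y.pt, ⟨(hεW (hsub h1)).2, ?_, fun h => h2 (ext_pt h)⟩, ofPoint_pt y⟩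
    exact (dist_pt_le y x).trans_lt h1
  · rintro ⟨p, ⟨h1, h2, h3⟩, rfl⟩
    refine ⟨?_, fun h => h3 ?_⟩
    · have h4 := dist_ofPoint_le hPc hP.subset h1 hx
      rw [ofPoint_pt] at h4
      exact h4.trans_lt h2
    · rw [mem_singleton_iff] at h ⊢
      rw [← h, pt_ofPoint (hP.subset h1)]

theorem not_isLocalCutPoint_of_disc {x : Bullseye a} {k : ℤ} (h2 : (x.pt : E3) 2 = 0)
    (hd : dist (x.pt : E3) !₂[3 / 2 * 2 ^ k, 0, 0] < 2 ^ k / 2) : ¬ IsLocalCutPoint x := by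
  have hx : (x.pt : E3) ∈ bullDisc k := ⟨h2, hd.le⟩
  have hk := zpow_two_pos k
  have hc : ‖(!₂[3 / 2 * 2 ^ k, 0, 0] : E3)‖ = 3 / 2 * 2 ^ k := by
    refine (sq_eq_sq₀ (norm_nonneg _) (by positivity)).1 ?_
    rw [E3_norm_sq]
    simp
  have hn1 := norm_sub_norm_le (x.pt : E3) (!₂[3 / 2 * 2 ^ k, 0, 0] : E3)
  have hn2 := norm_sub_norm_le (!₂[3 / 2 * 2 ^ k, 0, 0] : E3) (x.pt : E3)
  rw [norm_sub_rev] at hn2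
  rw [dist_eq_norm] at hd
  refine not_isLocalCutPoint_of_convex (IsBullPiece.disc k) (convex_bullDisc k) hx ?_
    (sub_pos.2 hd) fun r hr hrρ => ?_
  -- The open disc lies strictly between two consecutive circles and has positive first coordinate.
  -- These open conditions leave only points of the disc `k`.
  · have e1 : 2 ^ k < ‖(x.pt : E3)‖ := by linarith
    have e2 : ‖(x.pt : E3)‖ < 2 ^ (k + 1) := by rw [zpow_two_succ]; linarith
    filter_upwards [continuous_norm_pt.continuousAt.eventually_const_lt e1,
      continuous_norm_pt.continuousAt.eventually_lt_const e2,
      (continuous_coord 0).continuousAt.eventually_const_lt (hk.trans_le (le_of_mem_bullDisc hx))]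
      with y h3 h4 h5
    rcases y.pt.2 with h | ⟨j, h | h | h | ⟨-, h⟩⟩
    · obtain ⟨j, h6⟩ := exists_mem_bullDisc_of_axis h h5
      obtain ⟨h7, h8⟩ := norm_mem_of_bullDisc h6
      have h9 := zpow_two_lt_iff.1 (h7.trans_lt h4)
      have h10 := zpow_two_lt_iff.1 (h3.trans_le h8)
      rwa [show k = j by omega]
    · rw [h.2, zpow_two_lt_iff] at h3 h4
      omega
    · obtain ⟨h7, h8⟩ := norm_mem_of_bullDisc h
      have h9 := zpow_two_lt_iff.1 (h7.trans_lt h4)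
      have h10 := zpow_two_lt_iff.1 (h3.trans_le h8)
      rwa [show k = j by omega]
    · linarith [le_of_mem_bullBall h, zpow_two_pos j]
    · linarith [h.1]
  · convert isPreconnected_plane_ball_diff_singleton h2 hr using 1
    ext q
    refine ⟨fun h => ⟨h.1.1, h.2⟩, fun h => ⟨⟨h.1, ?_⟩, h.2⟩⟩
    have h3 : dist q x.pt < r := h.2.1
    have h4 := dist_triangle q x.pt (!₂[3 / 2 * 2 ^ k, 0, 0] : E3)
    rw [dist_eq_norm (x.pt : E3)] at h4
    linarith

theorem not_isLocalCutPoint_of_ball {x : Bullseye a} {k : ℤ}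
    (hd : dist (x.pt : E3) !₂[-(3 / 2 * 2 ^ k), 0, 0] < 2 ^ k / 2) : ¬ IsLocalCutPoint x := by
  have hx : (x.pt : E3) ∈ bullBall k := hd.le
  have hk := zpow_two_pos k
  have hc : ‖(!₂[-(3 / 2 * 2 ^ k), 0, 0] : E3)‖ = 3 / 2 * 2 ^ k := by
    refine (sq_eq_sq₀ (norm_nonneg _) (by positivity)).1 ?_
    rw [E3_norm_sq]
    simp
  have hn1 := norm_sub_norm_le (x.pt : E3) (!₂[-(3 / 2 * 2 ^ k), 0, 0] : E3)
  have hn2 := norm_sub_norm_le (!₂[-(3 / 2 * 2 ^ k), 0, 0] : E3) (x.pt : E3)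
  rw [norm_sub_rev] at hn2
  rw [dist_eq_norm] at hd
  refine not_isLocalCutPoint_of_convex (IsBullPiece.ball k) (convex_bullBall k) hx ?_
    (sub_pos.2 hd) fun r hr hrρ => ?_
  · have e1 : 2 ^ k < ‖(x.pt : E3)‖ := by linarith
    have e2 : ‖(x.pt : E3)‖ < 2 ^ (k + 1) := by rw [zpow_two_succ]; linarith
    have e3 : (x.pt : E3) 0 < 0 := by linarith [le_of_mem_bullBall hx]
    filter_upwards [continuous_norm_pt.continuousAt.eventually_const_lt e1,
      continuous_norm_pt.continuousAt.eventually_lt_const e2,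
      (continuous_coord 0).continuousAt.eventually_lt_const e3] with y h3 h4 h5
    rcases y.pt.2 with h | ⟨j, h | h | h | ⟨-, h⟩⟩
    · obtain ⟨j, h6⟩ := exists_mem_bullBall_of_axis h h5
      obtain ⟨h7, h8⟩ := norm_mem_of_bullBall h6
      have h9 := zpow_two_lt_iff.1 (h7.trans_lt h4)
      have h10 := zpow_two_lt_iff.1 (h3.trans_le h8)
      rwa [show k = j by omega]
    · rw [h.2, zpow_two_lt_iff] at h3 h4
      omega
    · linarith [le_of_mem_bullDisc h, zpow_two_pos j]
    · obtain ⟨h7, h8⟩ := norm_mem_of_bullBall h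
      have h9 := zpow_two_lt_iff.1 (h7.trans_lt h4)
      have h10 := zpow_two_lt_iff.1 (h3.trans_le h8)
      rwa [show k = j by omega]
    · linarith [h.1]
  · convert isPreconnected_E3_ball_diff_singleton (x.pt : E3) hr using 1
    refine inter_eq_right.2 fun q h => ?_
    have h3 : dist q x.pt < r := h.1
    have h4 := dist_triangle q x.pt (!₂[-(3 / 2 * 2 ^ k), 0, 0] : E3)
    rw [dist_eq_norm (x.pt : E3)] at h4
    change dist q _ ≤ _
    linarith

theorem mem_closure_of_center {x : Bullseye a} {P : Set E3} (hP : IsBullPiece a P)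
    (hPc : Convex ℝ P) (hx : (x.pt : E3) ∈ P) {c : E3} (hc : c ∈ P) {r : ℝ}
    (hr : 0 < r) (hxr : dist (x.pt : E3) c ≤ r) :
    x ∈ closure {y : Bullseye a | (y.pt : E3) ∈ P ∧ dist (y.pt : E3) c < r} := by
  have hline : ∀ t ∈ Icc (0 : ℝ) 1, AffineMap.lineMap (x.pt : E3) c t ∈ P := fun t ht =>
    hPc.segment_subset hx hc (by rw [segment_eq_image_lineMap]; exact mem_image_of_mem _ ht)
  have hIoo : Ioo (0 : ℝ) 1 ∈ 𝓝[>] (0 : ℝ) := Ioo_mem_nhdsGT one_pos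
  have hlim : Tendsto (fun t : ℝ => t * dist (x.pt : E3) c) (𝓝[>] 0) (𝓝 0) := by
    have h : Tendsto (fun t : ℝ => t * dist (x.pt : E3) c) (𝓝 0) (𝓝 (0 * dist (x.pt : E3) c)) :=
      (continuous_mul_const _).tendsto 0
    rw [zero_mul] at h
    exact h.mono_left nhdsWithin_le_nhds
  refine mem_closure_of_tendsto (f := fun t : ℝ => ofPoint a (AffineMap.lineMap (x.pt : E3) c t))
    (b := 𝓝[>] 0) ?_ ?_
  · rw [tendsto_iff_dist_tendsto_zero]
    refine squeeze_zero' (Eventually.of_forall fun _ => dist_nonneg) ?_ hlim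
    filter_upwards [hIoo] with t ht
    have h := dist_ofPoint_le hPc hP.subset (hline t (Ioo_subset_Icc_self ht)) hx
    rw [ofPoint_pt, dist_lineMap_left, Real.norm_of_nonneg ht.1.le] at h
    exact h
  · filter_upwards [hIoo] with t ht
    have h := hline t (Ioo_subset_Icc_self ht)
    simp only [pt_ofPoint (hP.subset h)]
    refine ⟨h, ?_⟩
    rw [dist_lineMap_right, Real.norm_of_nonneg (sub_pos.2 ht.2).le]
    nlinarith [ht.1, ht.2, dist_nonneg (x := (x.pt : E3)) (y := c)]

/-- Points of discs and balls are approached by moving towards the centre; the origin is a limit of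
centres of shrinking discs. -/
theorem mem_closure_not_isLocalCutPoint {x : Bullseye a} (hx : x ∉ thin a) :
    x ∈ closure {y : Bullseye a | ¬ IsLocalCutPoint y} := by
  have hdisc : ∀ k, (x.pt : E3) ∈ bullDisc k → x ∈ closure {y : Bullseye a | ¬ IsLocalCutPoint y} := by
    intro k hk
    have hk0 := zpow_two_pos k
    refine closure_mono ?_ (mem_closure_of_center (IsBullPiece.disc k) (convex_bullDisc k) hk
      (c := !₂[3 / 2 * 2 ^ k, 0, 0]) ⟨by simp, by rw [dist_self]; positivity⟩ (half_pos hk0) hk.2)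
    rintro y ⟨h1, h2⟩
    exact not_isLocalCutPoint_of_disc h1.1 h2
  have hball : ∀ k, (x.pt : E3) ∈ bullBall k → x ∈ closure {y : Bullseye a | ¬ IsLocalCutPoint y} := by
    intro k hk
    have hk0 := zpow_two_pos k
    refine closure_mono ?_ (mem_closure_of_center (IsBullPiece.ball k) (convex_bullBall k) hk
      (c := !₂[-(3 / 2 * 2 ^ k), 0, 0]) (by rw [bullBall, mem_ofPred_eq, dist_self]; positivity)
      (half_pos hk0) hk)
    rintro y ⟨h1, h2⟩
    exact not_isLocalCutPoint_of_ball h2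
  by_cases hax : (x.pt : E3) ∈ bullAxis
  · rcases lt_trichotomy ((x.pt : E3) 0) 0 with h | h | h
    · obtain ⟨k, hk⟩ := exists_mem_bullBall_of_axis hax h
      exact hball k hk
    · have hx0 : x = origin a := ext_pt (E3_ext h hax.1 hax.2)
      rw [hx0, Metric.mem_closure_iff]
      intro ε hε
      -- The centre of the disc `-n` has norm `3 / 2 * 2 ^ (-n)`, hence distance at most `9 * 2 ^
      -- (-n)` from the origin.
      obtain ⟨n, hn⟩ := exists_pow_lt_of_lt_one (show 0 < ε / 9 by positivity)
        (show (1 / 2 : ℝ) < 1 by norm_num)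
      have hc : (!₂[3 / 2 * (2 : ℝ) ^ (-(n : ℤ)), 0, 0] : E3) ∈ bullAxis := by constructor <;> simp
      let y : Bullseye a := ⟨⟨_, Or.inl hc⟩⟩
      refine ⟨y, not_isLocalCutPoint_of_disc (k := -n) hc.2
        (by rw [dist_self]; exact half_pos (zpow_two_pos _)), ?_⟩
      rw [dist_comm]
      refine (dist_origin_le y).trans_lt ?_
      have h2 : ‖(y.pt : E3)‖ = 3 / 2 * 2 ^ (-(n : ℤ)) := by
        refine (sq_eq_sq₀ (norm_nonneg _) (by positivity)).1 ?_
        rw [E3_norm_sq]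
        simp [y]
      rw [h2, zpow_neg, zpow_natCast, ← inv_pow, ← one_div]
      linarith
    · obtain ⟨k, hk⟩ := exists_mem_bullDisc_of_axis hax h
      exact hdisc k hk
  · have h : ∃ k, (x.pt : E3) ∈ bullDisc k ∨ (x.pt : E3) ∈ bullBall k := by
      by_contra! h
      exact hx ⟨hax, h⟩
    obtain ⟨k, h | h⟩ := h
    · exact hdisc k h
    · exact hball k h

theorem graphPart_eq_thin (a : ℤ → Fin 2) : graphPart (Bullseye a) = thin a := by
  refine Subset.antisymm (fun x hx => ?_) (thin_subset_graphPart a)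
  by_contra h
  obtain ⟨y, h1, h2⟩ := mem_closure_iff.1 (mem_closure_not_isLocalCutPoint h) _ isOpen_interior hx
  exact h2 (interior_subset (s := {p | IsLocalCutPoint p}) h1)

end Bullseye

/-! ### Components of the graph part -/

namespace Bullseye

variable {a : ℤ → Fin 2} {σ : ℝ} {s t : ℤ}

/-- The open half circles of radii `2 ^ s, …, 2 ^ t` on the side of the `x`-axis given by the
sign `σ`, together with the bridges between them. -/
def run (a : ℤ → Fin 2) (σ : ℝ) (s t : ℤ) : Set (Bullseye a) :=
  {x | x ∈ thin a ∧ 0 < σ * (x.pt : E3) 1 ∧ 2 ^ s ≤ ‖(x.pt : E3)‖ ∧ ‖(x.pt : E3)‖ ≤ 2 ^ t}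

/-- A half circle with its bridges to neighbouring half circles is a maximal run. -/
structure IsRun (a : ℤ → Fin 2) (σ : ℝ) (s t : ℤ) : Prop where
  sign : σ = 1 ∨ σ = -1
  le : s ≤ t
  inner : ∀ k, s ≤ k → k < t → σ = 1 ∧ a k = 1
  left : σ = 1 → a (s - 1) ≠ 1
  right : σ = 1 → a t ≠ 1

/-- Since the bridges `s - 1` and `t` are missing on the upper side, and all bridges on the lower
side, the closed bounds on the norm may be relaxed to strict bounds by the next radii. -/
theorem isOpen_run (h : IsRun a σ s t) : IsOpen (run a σ s t) := by
  have h1 : run a σ s t = thin a ∩ ({x | 0 < σ * (x.pt : E3) 1} ∩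
      ({x | 2 ^ (s - 1) < ‖(x.pt : E3)‖} ∩ {x | ‖(x.pt : E3)‖ < 2 ^ (t + 1)})) := by
    ext x
    constructor
    · rintro ⟨h1, h2, h3, h4⟩
      exact ⟨h1, h2, (zpow_two_lt_iff.2 (by omega)).trans_le h3,
        h4.trans_lt (zpow_two_lt_iff.2 (by omega))⟩
    · rintro ⟨h1, h2, h3, h4⟩
      refine ⟨h1, h2, ?_⟩
      simp only [mem_ofPred_eq] at h2 h3 h4
      obtain ⟨-, k, h5 | ⟨hk, h5, h6, h7⟩⟩ := thin_cases h1
      · rw [h5.2, zpow_two_lt_iff] at h3 h4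
        rw [h5.2, zpow_two_le_iff, zpow_two_le_iff]
        omega
      · have hσ : σ = 1 := by
          refine h.sign.resolve_right fun h8 => ?_
          have := h5.2.2.1
          rw [h8] at h2
          linarith [zpow_two_pos k]
        have h8 := zpow_two_lt_iff.1 (h3.trans h7)
        have h9 := zpow_two_lt_iff.1 (h6.trans h4)
        have h10 : k ≠ s - 1 := fun e => h.left hσ (e ▸ hk)
        have h11 : k ≠ t := fun e => h.right hσ (e ▸ hk)
        exact ⟨(zpow_two_le_iff.2 (by omega)).trans h6.le,
          h7.le.trans (zpow_two_le_iff.2 (by omega))⟩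
  rw [h1]
  exact (isOpen_thin a).inter ((isOpen_lt continuous_const
    (continuous_const.mul (continuous_coord 1))).inter
    ((isOpen_lt continuous_const continuous_norm_pt).inter
      (isOpen_lt continuous_norm_pt continuous_const)))

theorem closure_run_subset : closure (run a σ s t) ⊆
    {x | 0 ≤ σ * (x.pt : E3) 1 ∧ 2 ^ s ≤ ‖(x.pt : E3)‖ ∧ ‖(x.pt : E3)‖ ≤ 2 ^ t} := by
  refine closure_minimal (fun x hx => ⟨hx.2.1.le, hx.2.2⟩) ?_
  exact (isClosed_le continuous_const (continuous_const.mul (continuous_coord 1))).inter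
    ((isClosed_le continuous_const continuous_norm_pt).inter
      (isClosed_le continuous_norm_pt continuous_const))

/-- Of the conditions defining a run, only the sign condition weakens in the closure, and thin
points are off the axis. -/
theorem closure_run_inter_thin (hσ : σ ≠ 0) : closure (run a σ s t) ∩ thin a ⊆ run a σ s t := by
  rintro x ⟨h1, h2⟩
  obtain ⟨h3, h4⟩ := closure_run_subset h1
  exact ⟨h2, h3.lt_of_ne' (mul_ne_zero hσ (thin_cases h2).1), h4⟩

/-- The open half circle of radius `2 ^ k` on the side `σ`. -/
def halfCircle (a : ℤ → Fin 2) (σ : ℝ) (k : ℤ) : Set (Bullseye a) :=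
  (fun θ => ofPoint a (bullArc k (σ * θ))) '' Ioo 0 Real.pi

theorem isPreconnected_halfCircle (a : ℤ → Fin 2) (σ : ℝ) (k : ℤ) :
    IsPreconnected (halfCircle a σ k) :=
  isPreconnected_Ioo.image _
    ((continuous_ofPoint_bullArc a k).comp (continuous_const_mul σ)).continuousOn

theorem mul_sin_mul_pos (hσ : σ = 1 ∨ σ = -1) {θ : ℝ} (hθ : θ ∈ Ioo 0 Real.pi) :
    0 < σ * Real.sin (σ * θ) := by
  have h := Real.sin_pos_of_mem_Ioo hθ
  rcases hσ with rfl | rfl <;> simpa using h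

theorem mem_halfCircle_iff (hσ : σ = 1 ∨ σ = -1) {k : ℤ} {x : Bullseye a} :
    x ∈ halfCircle a σ k ↔ (x.pt : E3) ∈ bullCircle k ∧ 0 < σ * (x.pt : E3) 1 := by
  have hk := zpow_two_pos k
  constructor
  · rintro ⟨θ, hθ, rfl⟩
    simp only [pt_ofPoint (bullArc_mem a k _)]
    refine ⟨bullArc_mem_bullCircle k _, ?_⟩
    rw [bullArc_one, mul_left_comm]
    exact mul_pos hk (mul_sin_mul_pos hσ hθ)
  · rintro ⟨h1, h2⟩
    obtain ⟨θ, h3, h4, h5⟩ := exists_bullArc_eq h1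
    have hs : 0 < σ * Real.sin θ := by
      rw [← h5, bullArc_one, mul_left_comm] at h2
      exact pos_of_mul_pos_right h2 hk.le
    have hσσ : σ * σ = 1 := by rcases hσ with rfl | rfl <;> norm_num
    refine ⟨σ * θ, ?_, ?_⟩
    · rcases hσ with rfl | rfl
      · rw [one_mul] at hs ⊢
        constructor
        · by_contra! h
          linarith [Real.sin_nonpos_of_nonpos_of_neg_pi_le h h3.le]
        · refine h4.lt_of_ne fun h => ?_
          rw [h, Real.sin_pi] at hs
          exact lt_irrefl _ hs
      · have h6 : Real.sin θ < 0 := by linarith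
        constructor
        · by_contra! h
          linarith [Real.sin_nonneg_of_nonneg_of_le_pi (x := θ) (by linarith) h4]
        · linarith
    · simp only [← mul_assoc, hσσ, one_mul, h5, ofPoint_pt]

theorem halfCircle_subset_thin (hσ : σ = 1 ∨ σ = -1) (k : ℤ) : halfCircle a σ k ⊆ thin a := by
  intro x hx
  obtain ⟨h1, h2⟩ := (mem_halfCircle_iff hσ).1 hx
  exact mem_thin_of_circle h1 fun h => by simp [h] at h2

theorem top_mem_halfCircle (σ : ℝ) (k : ℤ) :
    ofPoint a (bullArc k (σ * (Real.pi / 2))) ∈ halfCircle a σ k :=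
  ⟨_, ⟨by linarith [Real.pi_pos], by linarith [Real.pi_pos]⟩, rfl⟩

theorem bullArc_end_mem_closure (hσ : σ = 1 ∨ σ = -1) (k : ℤ) {φ : ℝ} (hφ : φ = 0 ∨ φ = Real.pi) :
    ofPoint a (bullArc k φ) ∈ closure (halfCircle a σ k) := by
  have hc := (continuous_ofPoint_bullArc a k).comp (continuous_const_mul σ)
  have h1 : φ ∈ closure (Ioo 0 Real.pi) := by
    rw [closure_Ioo Real.pi_pos.ne]
    rcases hφ with rfl | rfl
    · exact left_mem_Icc.2 Real.pi_pos.le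
    · exact right_mem_Icc.2 Real.pi_pos.le
  -- Both half circles have the same endpoints, since the arguments `π` and `-π` give the same
  -- point.
  have h2 : bullArc k φ = bullArc k (σ * φ) := by
    rcases hσ with rfl | rfl
    · rw [one_mul]
    · rcases hφ with rfl | rfl <;> simp [bullArc]
  rw [h2]
  exact image_closure_subset_closure_image hc (mem_image_of_mem _ h1)

theorem halfCircle_subset_run (hσ : σ = 1 ∨ σ = -1) {k : ℤ} (h1 : s ≤ k) (h2 : k ≤ t) :
    halfCircle a σ k ⊆ run a σ s t := by
  intro x hx
  have h3 := (mem_halfCircle_iff hσ).1 hx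
  refine ⟨halfCircle_subset_thin hσ k hx, h3.2, ?_⟩
  rw [h3.1.2, zpow_two_le_iff, zpow_two_le_iff]
  exact ⟨h1, h2⟩

/-- The part of the `y`-axis on the side `σ` at distances between `2 ^ s` and `2 ^ t`. -/
def ySegment (σ : ℝ) (s t : ℤ) : Set E3 :=
  {p | p 0 = 0 ∧ p 2 = 0 ∧ 2 ^ s ≤ σ * p 1 ∧ σ * p 1 ≤ 2 ^ t}

theorem convex_ySegment : Convex ℝ (ySegment σ s t) := by
  rintro p ⟨h1, h2, h3, h4⟩ q ⟨g1, g2, g3, g4⟩ u v hu hv huv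
  refine ⟨by simp [h1, g1], by simp [h2, g2], ?_, ?_⟩
  · calc (2 : ℝ) ^ s = u * 2 ^ s + v * 2 ^ s := by rw [← add_mul, huv, one_mul]
      _ ≤ u * (σ * p 1) + v * (σ * q 1) := by gcongr
      _ = _ := by simp; ring
  · calc _ = u * (σ * p 1) + v * (σ * q 1) := by simp; ring
      _ ≤ u * 2 ^ t + v * 2 ^ t := by gcongr
      _ = _ := by rw [← add_mul, huv, one_mul]

theorem isClosed_ySegment : IsClosed (ySegment σ s t) :=
  (isClosed_eq (continuous_E3_apply 0) continuous_const).inter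
    ((isClosed_eq (continuous_E3_apply 2) continuous_const).inter
    ((isClosed_le continuous_const (continuous_const.mul (continuous_E3_apply 1))).inter
    (isClosed_le (continuous_const.mul (continuous_E3_apply 1)) continuous_const)))

theorem norm_of_mem_ySegment (hσ : σ = 1 ∨ σ = -1) {p : E3} (hp : p ∈ ySegment σ s t) :
    ‖p‖ = σ * p 1 := by
  refine (sq_eq_sq₀ (norm_nonneg _) ((zpow_two_pos s).le.trans hp.2.2.1)).1 ?_
  rw [E3_norm_sq, hp.1, hp.2.1]
  rcases hσ with rfl | rfl <;> ring

theorem ySegment_subset (h : IsRun a σ s t) : ySegment σ s t ⊆ bullseyeSet a := by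
  intro p hp
  have hn := norm_of_mem_ySegment h.sign hp
  obtain ⟨h0, h2, h3, h4⟩ := hp
  obtain ⟨k, hk1, hk2⟩ := exists_mem_Ico_zpow ((zpow_two_pos s).trans_le h3)
    (one_lt_two : (1 : ℝ) < 2)
  rcases h4.lt_or_eq with h5 | h5
  · have h6 := zpow_two_lt_iff.1 (h3.trans_lt hk2)
    have h7 := zpow_two_lt_iff.1 (hk1.trans_lt h5)
    obtain ⟨hσ, hak⟩ := h.inner k (by omega) h7
    rw [hσ, one_mul] at hk1 hk2
    exact (IsBullPiece.bridge k hak).subset ⟨h0, h2, hk1, hk2.le⟩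
  · exact (IsBullPiece.circle t).subset ⟨h2, by rw [hn, h5]⟩

theorem ySegment_image_subset_run (h : IsRun a σ s t) :
    ofPoint a '' ySegment σ s t ⊆ run a σ s t := by
  rintro _ ⟨p, hp, rfl⟩
  have hpt := pt_ofPoint (ySegment_subset h hp)
  have hpos : 0 < σ * p 1 := (zpow_two_pos s).trans_le hp.2.2.1
  refine ⟨mem_thin_of_coord ?_ ?_, ?_⟩
  · rw [hpt]; exact hp.1
  · rw [hpt]
    intro h1
    simp [h1] at hpos
  · rw [hpt, norm_of_mem_ySegment h.sign hp]
    exact ⟨hpos, hp.2.2⟩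

theorem top_mem_ySegment (hσ : σ = 1 ∨ σ = -1) {k : ℤ} (h1 : s ≤ k) (h2 : k ≤ t) :
    bullArc k (σ * (Real.pi / 2)) ∈ ySegment σ s t := by
  have h3 := zpow_two_le_iff.2 h1
  have h4 := zpow_two_le_iff.2 h2
  rcases hσ with rfl | rfl
  · refine ⟨by simp, by simp, ?_, ?_⟩ <;> simpa
  · refine ⟨by simp, by simp, ?_, ?_⟩ <;> simpa

theorem mem_run_cases (h : IsRun a σ s t) {x : Bullseye a} (hx : x ∈ run a σ s t) :
    (∃ k, s ≤ k ∧ k ≤ t ∧ x ∈ halfCircle a σ k) ∨ (x.pt : E3) ∈ ySegment σ s t := by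
  obtain ⟨h1, h2, h3, h4⟩ := hx
  obtain ⟨-, k, h5 | ⟨hk, h5, -⟩⟩ := thin_cases h1
  · refine Or.inl ⟨k, ?_, ?_, (mem_halfCircle_iff h.sign).2 ⟨h5, h2⟩⟩
    · rwa [h5.2, zpow_two_le_iff] at h3
    · rwa [h5.2, zpow_two_le_iff] at h4
  · have hσ : σ = 1 := by
      refine h.sign.resolve_right fun h8 => ?_
      have := h5.2.2.1
      rw [h8] at h2
      linarith [zpow_two_pos k]
    have h6 := norm_eq_of_bullBridge h5
    exact Or.inr ⟨h5.1, h5.2.1, by rwa [hσ, one_mul, ← h6], by rwa [hσ, one_mul, ← h6]⟩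

/-- The segment of the `y`-axis is a spine that meets each half circle of the run at its midpoint;
for `s = t` it is a single point. -/
theorem isPreconnected_run (h : IsRun a σ s t) : IsPreconnected (run a σ s t) := by
  have hY : IsPreconnected (ofPoint a '' ySegment σ s t) :=
    convex_ySegment.isPreconnected.image _
      (continuousOn_ofPoint convex_ySegment (ySegment_subset h))
  have hYr := ySegment_image_subset_run h
  have htop : ∀ k, s ≤ k → k ≤ t →
      ofPoint a (bullArc k (σ * (Real.pi / 2))) ∈ ofPoint a '' ySegment σ s t :=
    fun k h1 h2 => mem_image_of_mem _ (top_mem_ySegment h.sign h1 h2)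
  refine isPreconnected_of_forall (ofPoint a (bullArc s (σ * (Real.pi / 2)))) fun x hx => ?_
  rcases mem_run_cases h hx with ⟨k, h1, h2, h3⟩ | h1
  · exact ⟨halfCircle a σ k ∪ ofPoint a '' ySegment σ s t,
      union_subset (halfCircle_subset_run h.sign h1 h2) hYr, Or.inr (htop s le_rfl h.le), Or.inl h3,
      (isPreconnected_halfCircle a σ k).union _ (top_mem_halfCircle σ k) (htop k h1 h2) hY⟩
  · exact ⟨_, hYr, htop s le_rfl h.le, ⟨_, h1, ofPoint_pt x⟩, hY⟩

theorem isGraphComponent_run (h : IsRun a σ s t) : IsGraphComponent (run a σ s t) where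
  nonempty := ⟨_, halfCircle_subset_run h.sign le_rfl h.le (top_mem_halfCircle σ s)⟩
  isPreconnected := isPreconnected_run h
  isOpen := isOpen_run h
  subset := by
    rw [graphPart_eq_thin]
    exact fun x hx => hx.1
  closure_inter_subset := by
    rw [graphPart_eq_thin]
    exact closure_run_inter_thin (by rcases h.sign with rfl | rfl <;> norm_num)

/-- A boundary point is not thin, hence lies on one of the finitely many circles and on the axis.
Conversely, both ends of each half circle are limits of the run. -/
theorem frontier_run (h : IsRun a σ s t) : frontier (run a σ s t) =
    (fun i : ℤ × Bool => ofPoint a (bullArc i.1 (if i.2 then 0 else Real.pi))) ''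
      (Icc s t ×ˢ univ) := by
  have hσ0 : σ ≠ 0 := by rcases h.sign with rfl | rfl <;> norm_num
  rw [(isOpen_run h).frontier_eq]
  ext x
  constructor
  · rintro ⟨hx, hxr⟩
    have hxt : x ∉ thin a := fun hxt => hxr (closure_run_inter_thin hσ0 ⟨hx, hxt⟩)
    have hF : (x.pt : E3) ∈ (⋃ k ∈ Icc s t, bullCircle k) ∪ ySegment σ s t := by
      have hcl : IsClosed ((⋃ k ∈ Icc s t, bullCircle k) ∪ ySegment σ s t) :=
        ((finite_Icc s t).isClosed_biUnion fun k _ => isClosed_bullCircle k).union isClosed_ySegment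
      refine (closure_minimal (fun y hy => ?_) (hcl.preimage continuous_pt) :
        closure (run a σ s t) ⊆ _) hx
      rcases mem_run_cases h hy with ⟨k, h1, h2, h3⟩ | h1
      · exact Or.inl (mem_biUnion (mem_Icc.2 ⟨h1, h2⟩) ((mem_halfCircle_iff h.sign).1 h3).1)
      · exact Or.inr h1
    rcases hF with hF | hF
    · obtain ⟨k, hk, hxk⟩ := mem_iUnion₂.1 hF
      have h1 : (x.pt : E3) 1 = 0 := by
        by_contra h1
        exact hxt (mem_thin_of_circle hxk h1)
      have h2 := E3_norm_sq (x.pt : E3)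
      have h3 : (x.pt : E3) 2 = 0 := hxk.1
      rw [hxk.2, h1, h3] at h2
      have h4 : (x.pt : E3) 0 ^ 2 = (2 ^ k) ^ 2 := by linarith
      rcases sq_eq_sq_iff_eq_or_eq_neg.1 h4 with h5 | h5
      · refine ⟨(k, true), ⟨hk, mem_univ _⟩, ?_⟩
        rw [← ofPoint_pt x]
        refine congrArg (ofPoint a) (E3_ext ?_ ?_ ?_) <;> simp [h1, h3, h5]
      · refine ⟨(k, false), ⟨hk, mem_univ _⟩, ?_⟩
        rw [← ofPoint_pt x]
        refine congrArg (ofPoint a) (E3_ext ?_ ?_ ?_) <;> simp [h1, h3, h5]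
    · exact absurd (closure_run_inter_thin hσ0 ⟨hx, mem_thin_of_coord hF.1 fun h1 => by
        have := (zpow_two_pos s).trans_le hF.2.2.1
        simp [h1] at this⟩) hxr
  · rintro ⟨⟨k, ε⟩, ⟨hk, -⟩, rfl⟩
    refine ⟨closure_mono (halfCircle_subset_run h.sign hk.1 hk.2)
      (bullArc_end_mem_closure h.sign k (by cases ε <;> simp)), fun hr => ?_⟩
    have := hr.2.1
    rw [pt_ofPoint (bullArc_mem a k _)] at this
    cases ε <;> simp at this

theorem ncard_frontier_run (h : IsRun a σ s t) :
    (frontier (run a σ s t)).ncard = 2 * (t + 1 - s).toNat := by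
  rw [frontier_run h, InjOn.ncard_image]
  · have h1 : (Icc s t ×ˢ (univ : Set Bool)) =
        ((Finset.Icc s t ×ˢ (Finset.univ : Finset Bool) : Finset (ℤ × Bool)) : Set (ℤ × Bool)) := by
      rw [Finset.coe_product, Finset.coe_Icc, Finset.coe_univ]
    rw [h1, ncard_coe_finset, Finset.card_product]
    simp [mul_comm]
  · rintro ⟨k, ε⟩ - ⟨j, δ⟩ - hkj
    have h1 := congrArg (fun x : Bullseye a => (x.pt : E3)) hkj
    simp only [pt_ofPoint (bullArc_mem a _ _)] at h1
    have h2 := congrArg norm h1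
    rw [norm_bullArc, norm_bullArc] at h2
    have h3 : k = j := le_antisymm (zpow_two_le_iff.1 h2.le) (zpow_two_le_iff.1 h2.ge)
    subst h3
    have h4 := congrArg (fun p : E3 => p 0) h1
    have hk := zpow_two_pos k
    cases ε <;> cases δ <;> simp at h4 ⊢ <;> linarith

/-- If the bridges near the origin form runs of exactly `M - 1`, then there are arbitrarily small
components with `2 * M` boundary points. -/
theorem hasSmallComponents {M : ℕ} (hM : 2 ≤ M) (ha : ∀ k : ℤ, k ≤ 0 → (a k = 1 ↔ ¬ (M : ℤ) ∣ k)) :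
    HasSmallComponents (Bullseye a) (2 * M) := by
  refine ⟨origin a, fun V hV => ?_⟩
  obtain ⟨ε, hε, hεV⟩ := Metric.mem_nhds_iff.1 hV
  obtain ⟨n, hn⟩ := exists_pow_lt_of_lt_one (show 0 < ε / 6 by positivity)
    (show (1 / 2 : ℝ) < 1 by norm_num)
  have hM0 : (0 : ℤ) < M := by omega
  -- The bridges whose indices are the consecutive multiples `M * (-n - 1)` and `M * -n` are
  -- missing, which isolates the `M` half circles between them.
  have hrun : IsRun a 1 (M * (-(n : ℤ) - 1) + 1) (M * -(n : ℤ)) := by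
    have h0 : (M : ℤ) * -(n : ℤ) ≤ 0 := by nlinarith
    refine ⟨Or.inl rfl, by nlinarith, fun k h1 h2 => ⟨rfl, (ha k (by linarith)).2 ?_⟩, fun _ => ?_,
      fun _ => ?_⟩
    · rintro ⟨c, rfl⟩
      have h3 := lt_of_mul_lt_mul_left h2 hM0.le
      have h4 : (-(n : ℤ) - 1) < c := lt_of_mul_lt_mul_left (by omega) hM0.le
      omega
    · rw [add_sub_cancel_right, ne_eq, ha _ (by nlinarith), not_not]
      exact dvd_mul_right _ _
    · rw [ne_eq, ha _ h0, not_not]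
      exact dvd_mul_right _ _
  refine ⟨_, fun x hx => hεV ?_, isGraphComponent_run hrun, ?_⟩
  · refine (dist_origin_le x).trans_lt ?_
    have h1 : ‖(x.pt : E3)‖ ≤ 2 ^ (-(n : ℤ)) :=
      hx.2.2.2.trans (zpow_two_le_iff.2 (by nlinarith))
    rw [zpow_neg, zpow_natCast, ← inv_pow, ← one_div] at h1
    linarith
  · rw [ncard_frontier_run hrun]
    congr 1
    rw [show (M : ℤ) * -(n : ℤ) + 1 - (M * (-(n : ℤ) - 1) + 1) = M by ring, Int.toNat_natCast]

/-- A homeomorphism need not fix the origin, so the point is arbitrary. A component in a ball of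
radius `1 / 2` is too small to involve circles of index `k ≥ 0`, and for negative indices the
periodic pattern determines all runs. A neighbourhood of this one size is enough. -/
theorem eq_of_hasSmallComponents {M n : ℕ} (hM : 2 ≤ M)
    (ha : ∀ k : ℤ, k ≤ 0 → (a k = 1 ↔ ¬ (M : ℤ) ∣ k))
    (h : HasSmallComponents (Bullseye a) n) : n = 2 ∨ n = 2 * M := by
  obtain ⟨x₀, hx₀⟩ := h
  obtain ⟨K, hKV, hK, hn⟩ := hx₀ _ (Metric.ball_mem_nhds x₀ (show (0 : ℝ) < 1 / 2 by norm_num))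
  have hM0 : (0 : ℤ) < M := by omega
  obtain ⟨x, hx⟩ := hK.nonempty
  have hKt := hK.subset
  rw [graphPart_eq_thin] at hKt
  -- A half circle that meets `K` lies in `K`, so its endpoints, at distance at least `2 * 2 ^ k`,
  -- are both within `1 / 2` of `x₀`.
  have neg_of_mem : ∀ σ : ℝ, ∀ k : ℤ, (σ = 1 ∨ σ = -1) → (halfCircle a σ k ∩ K).Nonempty →
      k ≤ -1 := by
    intro σ k hσ hne
    have h1 := hK.subset_of_isPreconnected (isPreconnected_halfCircle a σ k)
      (by rw [graphPart_eq_thin]; exact halfCircle_subset_thin hσ k) hne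
    have h2 : ∀ φ, (φ = 0 ∨ φ = Real.pi) → dist (ofPoint a (bullArc k φ)) x₀ ≤ 1 / 2 := fun φ hφ =>
      (closure_minimal ((h1.trans hKV).trans Metric.ball_subset_closedBall)
        Metric.isClosed_closedBall : closure (halfCircle a σ k) ⊆ _) (bullArc_end_mem_closure hσ k hφ)
    have h3 := dist_triangle_right (ofPoint a (bullArc k 0)) (ofPoint a (bullArc k Real.pi)) x₀
    have h4 := dist_pt_le (ofPoint a (bullArc k 0)) (ofPoint a (bullArc k Real.pi))
    rw [pt_ofPoint (bullArc_mem a k _), pt_ofPoint (bullArc_mem a k _)] at h4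
    have h5 : 2 * 2 ^ k ≤ dist (bullArc k 0) (bullArc k Real.pi) := by
      refine (sq_le_sq₀ (by positivity) dist_nonneg).1 ?_
      rw [dist_bullArc_sq, zero_sub, Real.cos_neg, Real.cos_pi]
      linarith
    have h6 : (2 : ℝ) ^ (k + 1) ≤ 2 ^ (0 : ℤ) := by
      rw [zpow_two_succ, zpow_zero]
      linarith [h2 0 (Or.inl rfl), h2 _ (Or.inr rfl)]
    have := zpow_two_le_iff.1 h6
    omega
  have card : ∀ {σ : ℝ} {s t : ℤ}, IsRun a σ s t → x ∈ run a σ s t → n = 2 * (t + 1 - s).toNat := by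
    intro σ s t hr hxr
    rw [← ncard_frontier_run hr, ← hK.eq_of_mem (isGraphComponent_run hr) hx hxr, hn]
  have upper : ∀ k : ℤ, k ≤ -1 → 0 < (x.pt : E3) 1 → 2 ^ k ≤ ‖(x.pt : E3)‖ →
      (‖(x.pt : E3)‖ ≤ 2 ^ k ∨ (a k = 1 ∧ ‖(x.pt : E3)‖ ≤ 2 ^ (k + 1))) → n = 2 * M := by
    intro k hk h1 h2 h3
    -- Dividing `k - 1` rather than `k` gives `M * u + 1 ≤ k ≤ M * (u + 1)`, so a multiple of `M` is
    -- the last circle of its run.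
    set u := (k - 1) / (M : ℤ) with hu
    have hdiv := Int.mul_ediv_add_emod (k - 1) M
    have hm0 := Int.emod_nonneg (k - 1) hM0.ne'
    have hm1 := Int.emod_lt_of_pos (k - 1) hM0
    rw [← hu] at hdiv
    have hu1 : u < 0 := Int.ediv_neg_of_neg_of_pos (by omega) hM0
    have hexp : (M : ℤ) * (u + 1) = M * u + M := by ring
    have hneg : (M : ℤ) * (u + 1) ≤ 0 := by nlinarith
    have hrun : IsRun a 1 (M * u + 1) (M * (u + 1)) := by
      refine ⟨Or.inl rfl, by omega, fun j h1 h2 => ⟨rfl, (ha j (by omega)).2 ?_⟩, fun _ => ?_,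
        fun _ => ?_⟩
      · rintro ⟨c, rfl⟩
        have h3 := lt_of_mul_lt_mul_left h2 hM0.le
        have h4 : u < c := lt_of_mul_lt_mul_left (by omega) hM0.le
        omega
      · rw [add_sub_cancel_right, ne_eq, ha _ (by omega), not_not]
        exact dvd_mul_right _ _
      · rw [ne_eq, ha _ hneg, not_not]
        exact dvd_mul_right _ _
    rw [card hrun ⟨hKt hx, by rwa [one_mul], (zpow_two_le_iff.2 (by omega)).trans h2, ?_⟩]
    · congr 1
      rw [show (M : ℤ) * (u + 1) + 1 - (M * u + 1) = M by ring, Int.toNat_natCast]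
    · rcases h3 with h3 | ⟨h3, h4⟩
      · exact h3.trans (zpow_two_le_iff.2 (by omega))
      · refine h4.trans (zpow_two_le_iff.2 ?_)
        -- A present bridge has index prime to the pattern of gaps, that is, not a multiple of `M`;
        -- hence its outer end `k + 1` is still in the run.
        have h5 : k ≠ M * (u + 1) := fun h5 => (ha k (by omega)).1 h3 (h5 ▸ dvd_mul_right _ _)
        omega
  obtain ⟨hx1, k, hk | ⟨hak, hk, hk1, hk2⟩⟩ := thin_cases (hKt hx)
  · rcases lt_or_gt_of_ne hx1 with h1 | h1
    · left
      have hr : IsRun a (-1) k k :=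
        ⟨Or.inr rfl, le_rfl, fun j h2 h3 => by omega, fun h => by norm_num at h,
          fun h => by norm_num at h⟩
      rw [card hr ⟨hKt hx, by linarith, hk.2.ge, hk.2.le⟩, add_sub_cancel_left]
      rfl
    · right
      exact upper k (neg_of_mem 1 k (Or.inl rfl) ⟨x, (mem_halfCircle_iff (Or.inl rfl)).2
        ⟨hk, by rwa [one_mul]⟩, hx⟩) h1 hk.2.ge (Or.inl hk.2.le)
  · right
    -- The whole bridge lies in `K`, so `K` contains its inner endpoint, which is on the half circle
    -- `k`; thus the size bound applies to bridge points too.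
    refine upper k (neg_of_mem 1 k (Or.inl rfl) ⟨_, top_mem_halfCircle 1 k, ?_⟩)
      ((zpow_two_pos k).trans_le hk.2.2.1) hk1.le (Or.inr ⟨hak, hk2.le⟩)
    have hP := IsBullPiece.bridge k hak
    have hsub : ofPoint a '' bullBridge k ⊆ K := by
      refine hK.subset_of_isPreconnected ((convex_bullBridge k).isPreconnected.image _
        (continuousOn_ofPoint (convex_bullBridge k) hP.subset)) ?_ ⟨x, ⟨_, hk, ofPoint_pt x⟩, hx⟩
      rw [graphPart_eq_thin]
      rintro _ ⟨p, hp, rfl⟩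
      refine mem_thin_of_coord ?_ ?_ <;> rw [pt_ofPoint (hP.subset hp)]
      · exact hp.1
      · exact ((zpow_two_pos k).trans_le hp.2.2.1).ne'
    refine hsub (mem_image_of_mem _ ⟨by simp, by simp, by simp, ?_⟩)
    simp

end Bullseye

/-! ### The bridging sequences -/

theorem nat_lt_sixteen_pow (n : ℕ) : (n : ℤ) < 16 ^ n := by
  exact_mod_cast Nat.lt_pow_self (by norm_num : 1 < 16)

/-- Since `n < 16 ^ n`, the window is far from `0` compared with its radius. This makes the
recursion defining `bridgeSeq` terminate, although the index `i` increases. -/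
theorem natAbs_sub_window_lt {k : ℤ} {n : ℕ} (h : |k - 16 ^ (n + 1)| ≤ n) :
    (k - 16 ^ (n + 1)).natAbs < k.natAbs := by
  have h1 := nat_lt_sixteen_pow n
  rw [pow_succ] at h ⊢
  rw [abs_le] at h
  omega

open Classical in
/-- To the left of `0` the zeros are the multiples of `i + 2`, and to the right of `0` the sequence
vanishes except on the interval of radius `n` about `16 ^ (n + 1)`, `n ∈ ℕ`, which carries a copy of
the centre of the next sequence. -/
noncomputable def bridgeSeq (i : ℕ) (k : ℤ) : Fin 2 :=
  if 0 < k then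
    if w : ∃ n : ℕ, |k - 16 ^ (n + 1)| ≤ n then bridgeSeq (i + 1) (k - 16 ^ (w.choose + 1)) else 0
  else if ((i + 2 : ℕ) : ℤ) ∣ k then 0 else 1
termination_by k.natAbs
decreasing_by exact natAbs_sub_window_lt w.choose_spec

theorem bridgeSeq_of_nonpos (i : ℕ) {k : ℤ} (hk : k ≤ 0) :
    bridgeSeq i k = if ((i + 2 : ℕ) : ℤ) ∣ k then 0 else 1 := by
  rw [bridgeSeq, if_neg hk.not_gt]

theorem bridgeSeq_eq_one_iff (i : ℕ) {k : ℤ} (hk : k ≤ 0) :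
    bridgeSeq i k = 1 ↔ ¬ ((i + 2 : ℕ) : ℤ) ∣ k := by
  rw [bridgeSeq_of_nonpos i hk]
  by_cases h : ((i + 2 : ℕ) : ℤ) ∣ k
  · rw [if_pos h]
    simpa using! h
  · rw [if_neg h]
    simpa using! h

theorem bridgeSeq_eq_zero (i : ℕ) {k : ℤ} (hk : 0 < k)
    (h : ¬ ∃ n : ℕ, |k - 16 ^ (n + 1)| ≤ n) : bridgeSeq i k = 0 := by
  rw [bridgeSeq, if_pos hk, dif_neg h]

/-- The windows are disjoint, so the chosen one in the definition of `bridgeSeq` is the only one. -/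
theorem window_unique {k : ℤ} {n n' : ℕ} (h : |k - 16 ^ (n + 1)| ≤ n)
    (h' : |k - 16 ^ (n' + 1)| ≤ n') : n = n' := by
  have key : ∀ n n' : ℕ, |k - 16 ^ (n + 1)| ≤ n → |k - 16 ^ (n' + 1)| ≤ n' → ¬ n < n' := by
    intro n n' h h' hlt
    have h1 := nat_lt_sixteen_pow n'
    have h2 : (16 : ℤ) ^ (n + 1) ≤ 16 ^ n' := pow_le_pow_right₀ (by norm_num) hlt
    rw [pow_succ _ n'] at h'
    rw [abs_le] at h h'
    omega
  have := key n n' h h'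
  have := key n' n h' h
  omega

theorem bridgeSeq_add (i : ℕ) {k : ℤ} {n : ℕ} (hk : |k| ≤ n) :
    bridgeSeq i (k + 16 ^ (n + 1)) = bridgeSeq (i + 1) k := by
  have h1 := nat_lt_sixteen_pow n
  have hw : |k + 16 ^ (n + 1) - 16 ^ (n + 1)| ≤ n := by simpa using hk
  have hpos : 0 < k + 16 ^ (n + 1) := by
    rw [pow_succ]
    rw [abs_le] at hk
    omega
  have w : ∃ n' : ℕ, |k + 16 ^ (n + 1) - 16 ^ (n' + 1)| ≤ n' := ⟨n, hw⟩
  rw [bridgeSeq, if_pos hpos, dif_pos w, window_unique w.choose_spec hw, add_sub_cancel_right]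

/-- A fixed `k` is in the central block of radius `n` as soon as `n ≥ |k|`. This is the pointwise
convergence required by `exists_cone_isometryEquiv`. -/
theorem eventually_bridgeSeq_add (i : ℕ) (k : ℤ) :
    ∀ᶠ n : ℕ in atTop, bridgeSeq i (k + (16 ^ (n + 1) : ℕ)) = bridgeSeq (i + 1) k := by
  filter_upwards [eventually_ge_atTop k.natAbs] with n hn
  push_cast
  exact bridgeSeq_add i (by rw [Int.abs_eq_natAbs]; exact_mod_cast hn)

/-! ### Densities -/

theorem sum_Icc_neg (f : ℤ → ℝ) (N : ℕ) : ∑ k ∈ Finset.Icc (-(N : ℤ)) N, f k =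
    f 0 + ∑ j ∈ Finset.Ioc 0 N, f (-(j : ℤ)) + ∑ j ∈ Finset.Ioc 0 N, f j := by
  induction N with
  | zero => simp
  | succ N ih =>
    have h1 : Finset.Icc (-((N + 1 : ℕ) : ℤ)) ((N + 1 : ℕ) : ℤ) =
        insert ((N + 1 : ℕ) : ℤ) (insert (-((N + 1 : ℕ) : ℤ)) (Finset.Icc (-(N : ℤ)) N)) := by
      ext k
      simp only [Finset.mem_Icc, Finset.mem_insert]
      omega
    rw [h1, Finset.sum_insert, Finset.sum_insert, ih, ← Finset.insert_Ioc_right_eq_Ioc_add_one (by simp),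
      Finset.sum_insert (by simp), Finset.sum_insert (by simp)]
    · ring
    · simp only [Finset.mem_Icc]
      omega
    · simp only [Finset.mem_Icc, Finset.mem_insert]
      omega

theorem sum_bridgeSeq_neg (i N : ℕ) : ∑ j ∈ Finset.Ioc 0 N, ((bridgeSeq i (-(j : ℤ)) : ℕ) : ℝ) =
    N - (N / (i + 2) : ℕ) := by
  have h1 : ∀ j ∈ Finset.Ioc 0 N, ((bridgeSeq i (-(j : ℤ)) : ℕ) : ℝ) =
      1 - if (i + 2) ∣ j then 1 else 0 := by
    intro j _
    rw [bridgeSeq_of_nonpos i (by omega)]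
    simp only [dvd_neg, Int.natCast_dvd_natCast]
    split_ifs <;> simp
  rw [Finset.sum_congr rfl h1, Finset.sum_sub_distrib, Finset.sum_boole,
    Nat.Ioc_filter_dvd_card_eq_div]
  simp

/-- The window of index `n` starts beyond `16 ^ n ≥ (n + 1) ^ 4`, so at most about `N ^ (1 / 4)`
windows matter up to `N`. Their sizes `2 * n + 1` add up to a square `q * q ≤ √N`. -/
theorem sum_bridgeSeq_pos_le (i N : ℕ) :
    ∑ j ∈ Finset.Ioc 0 N, ((bridgeSeq i j : ℕ) : ℝ) ≤ Real.sqrt N := by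
  classical
  set q := Nat.sqrt (Nat.sqrt N) with hq
  let W : Finset ℕ := (Finset.range q).biUnion fun n => Finset.Icc (16 ^ (n + 1) - n) (16 ^ (n + 1) + n)
  have hW : ∀ j ∈ Finset.Ioc 0 N, ((bridgeSeq i j : ℕ) : ℝ) ≤ if j ∈ W then 1 else 0 := by
    intro j hj
    rw [Finset.mem_Ioc] at hj
    by_cases hw : ∃ n : ℕ, |(j : ℤ) - 16 ^ (n + 1)| ≤ n
    · have hjW : j ∈ W := by
        obtain ⟨n, hn⟩ := hw
        have h1 := nat_lt_sixteen_pow n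
        have h2 : (n + 1) ^ 4 ≤ 16 ^ n := by
          calc (n + 1) ^ 4 ≤ (2 ^ n) ^ 4 := Nat.pow_le_pow_left Nat.lt_two_pow_self 4
            _ = 16 ^ n := by rw [← pow_mul, mul_comm, pow_mul]; norm_num
        have h1' : n < 16 ^ n := by exact_mod_cast h1
        have h4 : 16 ^ (n + 1) - n ≤ j ∧ j ≤ 16 ^ (n + 1) + n := by
          rw [abs_le] at hn
          have : ((16 ^ (n + 1) : ℕ) : ℤ) = 16 ^ (n + 1) := by push_cast; rfl
          omega
        have h3 : (n + 1) ^ 4 ≤ N := by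
          have := pow_succ 16 n
          omega
        refine Finset.mem_biUnion.2 ⟨n, Finset.mem_range.2 ?_, Finset.mem_Icc.2 h4⟩
        refine Nat.lt_of_succ_le (Nat.le_sqrt.2 (Nat.le_sqrt.2 ?_))
        calc _ = (n + 1) ^ 4 := by rw [Nat.succ_eq_add_one]; ring
          _ ≤ N := h3
      rw [if_pos hjW]
      exact_mod_cast Nat.lt_succ_iff.1 (bridgeSeq i j).2
    · rw [bridgeSeq_eq_zero i (by omega) hw]
      split_ifs <;> simp
  have hcard : W.card ≤ Nat.sqrt N := by
    calc W.card ≤ ∑ n ∈ Finset.range q, (Finset.Icc (16 ^ (n + 1) - n) (16 ^ (n + 1) + n)).card :=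
          Finset.card_biUnion_le
      _ = ∑ n ∈ Finset.range q, (2 * n + 1) := by
          refine Finset.sum_congr rfl fun n _ => ?_
          have h1 := nat_lt_sixteen_pow n
          have h1' : n < 16 ^ n := by exact_mod_cast h1
          have := pow_succ 16 n
          rw [Nat.card_Icc]
          omega
      _ = q * q := by
          induction q with
          | zero => rfl
          | succ q ih => rw [Finset.sum_range_succ, ih]; ring
      _ ≤ Nat.sqrt N := Nat.sqrt_le _
  calc ∑ j ∈ Finset.Ioc 0 N, ((bridgeSeq i j : ℕ) : ℝ)
      ≤ ∑ j ∈ Finset.Ioc 0 N, if j ∈ W then 1 else 0 := Finset.sum_le_sum hW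
    _ = (((Finset.Ioc 0 N).filter (· ∈ W)).card : ℝ) := by rw [Finset.sum_boole]
    _ ≤ (W.card : ℝ) := by
        exact_mod_cast Finset.card_le_card fun j hj => (Finset.mem_filter.1 hj).2
    _ ≤ (Nat.sqrt N : ℝ) := by exact_mod_cast hcard
    _ ≤ Real.sqrt N := Real.nat_sqrt_le_real_sqrt

/-- The negative half has density `1 - 1 / (i + 2)` and the positive half density zero, so the
limsup is a limit. The error is at most `(√N + 2) / (2 * N + 1)`, which is bounded by `4 / (√N +
1)`. -/
theorem asymptoticDensity_bridgeSeq (i : ℕ) :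
    asymptoticDensity (bridgeSeq i) = (1 - 1 / ((i : ℝ) + 2)) / 2 := by
  refine Tendsto.limsup_eq ?_
  set c : ℝ := 1 - 1 / ((i : ℝ) + 2) with hc
  have hc0 : 0 ≤ c := by
    rw [hc, sub_nonneg, div_le_one (by positivity)]
    linarith [(Nat.cast_nonneg i : (0 : ℝ) ≤ i)]
  have hc1 : c ≤ 1 := by
    rw [hc]
    linarith [show (0 : ℝ) ≤ 1 / ((i : ℝ) + 2) by positivity]
  have hlim : Tendsto (fun N : ℕ => 4 / (Real.sqrt N + 1)) atTop (𝓝 0) :=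
    tendsto_const_nhds.div_atTop (tendsto_atTop_add_const_right _ _
      (Real.tendsto_sqrt_atTop.comp tendsto_natCast_atTop_atTop))
  rw [tendsto_iff_dist_tendsto_zero]
  refine squeeze_zero (fun _ => dist_nonneg) (fun N => ?_) hlim
  rw [sum_Icc_neg, sum_bridgeSeq_neg, Real.dist_eq]
  have h0 : ((bridgeSeq i 0 : ℕ) : ℝ) = 0 := by rw [bridgeSeq_of_nonpos i le_rfl]; simp
  set P := ∑ j ∈ Finset.Ioc 0 N, ((bridgeSeq i j : ℕ) : ℝ) with hP
  have hP0 : 0 ≤ P := Finset.sum_nonneg fun _ _ => Nat.cast_nonneg _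
  have hP1 : P ≤ Real.sqrt N := sum_bridgeSeq_pos_le i N
  have hs0 := Real.sqrt_nonneg N
  have hsN : Real.sqrt N ^ 2 = N := Real.sq_sqrt (Nat.cast_nonneg N)
  have hd1 : ((N / (i + 2) : ℕ) : ℝ) ≤ N / ((i : ℝ) + 2) := by
    have := Nat.cast_div_le (α := ℝ) (m := N) (n := i + 2)
    push_cast at this ⊢
    exact this
  have hd2 : N / ((i : ℝ) + 2) ≤ ((N / (i + 2) : ℕ) : ℝ) + 1 := by
    rw [div_le_iff₀ (by positivity)]
    have := Nat.lt_div_mul_add (a := N) (b := i + 2) (by omega)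
    have h2 : N ≤ (N / (i + 2) + 1) * (i + 2) := by
      rw [add_mul, one_mul]
      exact this.le
    exact_mod_cast h2
  have hNc : (N : ℝ) * c = N - N / ((i : ℝ) + 2) := by rw [hc]; ring
  rw [h0]
  have e1 : 1 / (2 * (N : ℝ) + 1) * (0 + (N - ((N / (i + 2) : ℕ) : ℝ)) + P) - c / 2 =
      (N - ((N / (i + 2) : ℕ) : ℝ) + P - N * c - c / 2) / (2 * N + 1) := by
    field_simp
    ring
  rw [e1, abs_div, abs_of_pos (show (0 : ℝ) < 2 * N + 1 by positivity),
    div_le_div_iff₀ (by positivity) (by positivity)]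
  have e2 : |(N : ℝ) - ((N / (i + 2) : ℕ) : ℝ) + P - N * c - c / 2| ≤ Real.sqrt N + 2 := by
    rw [abs_le]
    constructor <;> linarith
  nlinarith [sq_nonneg (Real.sqrt N - 1), mul_le_mul_of_nonneg_right e2 (by positivity : (0 : ℝ) ≤ Real.sqrt N + 1)]

/-! ### The main theorem -/

theorem isScalingFactor_zpow {m : ℕ → ℕ} (hm : Tendsto m atTop atTop) :
    IsScalingFactor fun n => 2 ^ (m n : ℤ) := by
  refine ⟨fun n => zpow_two_pos _, ?_⟩
  simpa [Function.comp_def] using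
    (tendsto_pow_atTop_atTop_of_one_lt (one_lt_two : (1 : ℝ) < 2)).comp hm

/-- Each cone advances the index of the sequence by one. Non-principality is used only to ensure
that properties of all large `n` hold `μ`-almost everywhere. -/
theorem exists_iterCone_isometryEquiv {μ : Ultrafilter ℕ} (hμ : ∀ n : ℕ, μ ≠ pure n) (i : ℕ) :
    ∃ φ : ((pointedBullseye (bridgeSeq 0)).iterCone μ
        (fun n => 2 ^ ((16 ^ (n + 1) : ℕ) : ℤ)) i).carrier ≃ᵢ Bullseye (bridgeSeq i),
      φ ((pointedBullseye (bridgeSeq 0)).iterCone μ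
        (fun n => 2 ^ ((16 ^ (n + 1) : ℕ) : ℤ)) i).base = Bullseye.origin (bridgeSeq i) := by
  induction i with
  | zero => exact ⟨IsometryEquiv.refl _, rfl⟩
  | succ i ih =>
    obtain ⟨e, he⟩ := ih
    exact exists_cone_isometryEquiv (m := fun n => 16 ^ (n + 1)) (ultrafilter_le_atTop hμ)
      (eventually_bridgeSeq_add i) _ e he

theorem mainTheorem2 :
    ∃ (a : ℤ → Fin 2) (α : ℕ → ℝ), IsScalingFactor α ∧
      (∀ μ : Ultrafilter ℕ, (∀ n : ℕ, μ ≠ pure n) → ∀ i j : ℕ, i ≠ j →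
        IsEmpty (((pointedBullseye a).iterCone μ α i).carrier ≃ₜ
          ((pointedBullseye a).iterCone μ α j).carrier)) ∧
      ∃ b : ℕ → ℤ → Fin 2,
        (∀ i j : ℕ, i ≠ j → asymptoticDensity (b i) ≠ asymptoticDensity (b j)) ∧
        ∀ μ : Ultrafilter ℕ, (∀ n : ℕ, μ ≠ pure n) → ∀ i : ℕ,
          ∃ φ : ((pointedBullseye a).iterCone μ α i).carrier ≃ᵢ Bullseye (b i),
            φ ((pointedBullseye a).iterCone μ α i).base = Bullseye.origin (b i) := by
  refine ⟨bridgeSeq 0, fun n => 2 ^ ((16 ^ (n + 1) : ℕ) : ℤ), isScalingFactor_zpow ?_, ?_,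
    bridgeSeq, ?_, fun μ hμ i => exists_iterCone_isometryEquiv hμ i⟩
  · exact (tendsto_pow_atTop_atTop_of_one_lt (by norm_num)).comp (tendsto_add_atTop_nat 1)
  · refine fun μ hμ i j hij => ⟨fun f => hij ?_⟩
    obtain ⟨φ, -⟩ := exists_iterCone_isometryEquiv hμ i
    obtain ⟨ψ, -⟩ := exists_iterCone_isometryEquiv hμ j
    -- The value `2 * (i + 2)` transported to the other space must be `2` or `2 * (j + 2)`; the
    -- first is impossible. Starting the gaps at `i + 2` rather than `i + 1` keeps it distinct from
    -- the value `2` of the lower half circles.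
    have h1 := (Bullseye.hasSmallComponents (M := i + 2) (by omega)
      fun k hk => bridgeSeq_eq_one_iff i hk).map
        ((φ.toHomeomorph.symm.trans f).trans ψ.toHomeomorph)
    have h2 := Bullseye.eq_of_hasSmallComponents (M := j + 2) (by omega)
      (fun k hk => bridgeSeq_eq_one_iff j hk) h1
    omega
  · intro i j hij h
    rw [asymptoticDensity_bridgeSeq, asymptoticDensity_bridgeSeq] at h
    have h1 : 1 / ((i : ℝ) + 2) = 1 / ((j : ℝ) + 2) := by linarith
    rw [one_div, one_div, inv_inj, add_left_inj, Nat.cast_inj] at h1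
    exact hij h1
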